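/- There exist non-discrete (Hausdorff) locally compact groups that are compactly generated, simple as abstract groups, and contain a cocompact lattice which is itself a simple group. Explicitly, let $d \geq 7$ with $d \equiv 0$ or $3 \pmod 4$, let $\Omega = \mathbb{Z}/d$, and let $\mathcal{T}_d$ be a $d$-regular tree with an edge colouring $c$ by $\Omega$ that restricts, at every vertex $v$, to a bijection $c_v$ from the set $E(v)$ of edges at $v$ onto $\Omega$. For $g \in \mathrm{Aut}(\mathcal{T}_d)$ and a vertex $v$, let $\sigma(g,v) = c_{gv} \circ g \circ c_v^{-1} \in \mathrm{Sym}(\Omega)$ be the local permutation of $g$ at $v$. For permutation groups $F \leq F' \leq \mathrm{Sym}(\Omega)$ with $F$ transitive, let $U(F)$ be the group of automorphisms $g$ with $\sigma(g,v) \in F$ for all $v$, and let $G(F,F')$ be the group of automorphisms $g$ with $\sigma(g,v) \in F'$ for all $v$ and $\sigma(g,v) \in F$ for all but finitely many $v$. Endow $U(F)$ with the topology of pointwise convergence on vertices and $G(F,F')$ with the group topology for which the inclusion $U(F) \hookrightarrow G(F,F')$ is continuous and open. Let $G(F,F')^{\star}$ be the subgroup of $G(F,F')$ of elements preserving each of the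 two blocks of the natural bipartition of the vertices of $\mathcal{T}_d$, with the subspace topology. Let $D_d \leq \mathrm{Sym}(d) = \mathrm{Sym}(\Omega)$ be the dihedral group of order $2d$, consisting of the maps $x \mapsto k + x$ and $x \mapsto k - x$ for $k \in \mathbb{Z}/d$, let $\mathrm{Alt}(d)$ be the alternating group on $\Omega$, and put $F' = \mathrm{Alt}(d)$ and $F = D_d \cap \mathrm{Alt}(d)$. Then $G(D_d, \mathrm{Sym}(d))^{\star}$ is a non-discrete, Hausdorff, locally compact, compactly generated, abstractly simple group, and $G(F,F')^{\star}$ is contained in it, is a cocompact lattice in it, and is a simple group. -/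

import Mathlib

open MeasureTheory

/-- A tree on the vertex set `V` with a colouring of its edges by `Ω` such that, at every vertex,
each colour occurs on exactly one incident edge. In particular the tree is regular, of degree the
cardinality of `Ω`. -/
structure ColoredTree (V Ω : Type*) where
  graph : SimpleGraph V
  isTree : graph.IsTree
  color : graph.edgeSet → Ω
  legal : ∀ v : V, Function.Bijective
    (fun w : graph.neighborSet v => color ⟨s(v, (w : V)), w.2⟩)

namespace ColoredTree

variable {V Ω : Type*} (T : ColoredTree V Ω)

/-- The automorphism group of the tree; the colouring need not be preserved. -/
abbrev Aut : Type _ := T.graph ≃g T.graph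

/-- The bijection from the edges at `v` (given by their endpoints other than `v`) to the
colours. -/
noncomputable def colorEquiv (v : V) : T.graph.neighborSet v ≃ Ω :=
  Equiv.ofBijective _ (T.legal v)

/-- The local permutation of the automorphism `g` at the vertex `v`. -/
noncomputable def localPerm (g : T.Aut) (v : V) : Equiv.Perm Ω :=
  (T.colorEquiv v).symm.trans ((g.mapNeighborSet v).trans (T.colorEquiv (g v)))

theorem localPerm_one (v : V) : T.localPerm 1 v = 1 := by
  ext a
  exact (T.colorEquiv v).apply_symm_apply a

theorem localPerm_mul (g h : T.Aut) (v : V) :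
    T.localPerm (g * h) v = T.localPerm g (h v) * T.localPerm h v := by
  ext a
  change _ = T.colorEquiv (g (h v)) (g.mapNeighborSet (h v)
    ((T.colorEquiv (h v)).symm (T.colorEquiv (h v) _)))
  rw [Equiv.symm_apply_apply]
  rfl

theorem localPerm_inv (g : T.Aut) (v : V) :
    T.localPerm g⁻¹ v = (T.localPerm g (g⁻¹ v))⁻¹ := by
  have h := T.localPerm_mul g g⁻¹ v
  rw [mul_inv_cancel, localPerm_one] at h
  exact (inv_eq_of_mul_eq_one_right h.symm).symm

/-- The Burger-Mozes group `U(F)`: all local permutations lie in `F`. -/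
def burgerMozes (F : Subgroup (Equiv.Perm Ω)) : Subgroup T.Aut where
  carrier := {g | ∀ v, T.localPerm g v ∈ F}
  one_mem' := fun v => by rw [localPerm_one]; exact F.one_mem
  mul_mem' := fun {g h} hg hh v => by
    rw [localPerm_mul]; exact F.mul_mem (hg _) (hh _)
  inv_mem' := fun {g} hg v => by
    rw [localPerm_inv]; exact F.inv_mem (hg _)

/-- The group `G(F, F')`: all local permutations lie in `F'`, and all but finitely many of them
lie in `F`. -/
def almostPrescribed (F F' : Subgroup (Equiv.Perm Ω)) : Subgroup T.Aut where
  carrier := {g | (∀ v, T.localPerm g v ∈ F') ∧ {v | T.localPerm g v ∉ F}.Finite}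
  one_mem' := by
    refine ⟨fun v => by rw [localPerm_one]; exact F'.one_mem, ?_⟩
    convert Set.finite_empty
    ext v
    simp [localPerm_one, F.one_mem]
  mul_mem' := fun {g h} hg hh => by
    refine ⟨fun v => by rw [localPerm_mul]; exact F'.mul_mem (hg.1 _) (hh.1 _), ?_⟩
    refine (hh.2.union (hg.2.preimage (f := h) h.injective.injOn)).subset fun v hv => ?_
    by_contra hc
    simp only [Set.mem_union, Set.mem_ofPred_eq, Set.mem_preimage, not_or, not_not] at hc
    exact hv (by rw [localPerm_mul]; exact F.mul_mem hc.2 hc.1)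
  inv_mem' := fun {g} hg => by
    refine ⟨fun v => by rw [localPerm_inv]; exact F'.inv_mem (hg.1 _), ?_⟩
    refine (hg.2.preimage (f := (g⁻¹ : T.Aut)) (g⁻¹ : T.Aut).injective.injOn).subset
      fun v hv => ?_
    intro hc
    exact hv (by rw [localPerm_inv]; exact F.inv_mem hc)

/-- The type-preserving automorphisms: those preserving, for every vertex `v`, the set of vertices
at even distance from `v`. These sets are the blocks of the natural bipartition of the tree. -/
def typePreserving : Subgroup T.Aut where
  carrier := {g | ∀ v w, Even (T.graph.dist v (g w)) ↔ Even (T.graph.dist v w)}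
  one_mem' := fun _ _ => Iff.rfl
  mul_mem' := fun {g h} hg hh v w => (hg v (h w)).trans (hh v w)
  inv_mem' := fun {g} hg v w => by
    have := hg v (g⁻¹ w)
    rw [RelIso.apply_inv_self] at this
    exact this.symm

/-- The type-preserving subgroup of `G(F, F')`. -/
def almostPrescribedStar (F F' : Subgroup (Equiv.Perm Ω)) : Subgroup T.Aut :=
  T.almostPrescribed F F' ⊓ T.typePreserving

/-- The group topology of `G(F, F')`: a basis of neighbourhoods of `g` is given by the cosets
`g * U(F)_S`, where `U(F)_S` is the pointwise stabilizer in `U(F)` of a finite set `S` of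
vertices. -/
instance topologicalSpaceAlmostPrescribed (F F' : Subgroup (Equiv.Perm Ω)) :
    TopologicalSpace (T.almostPrescribed F F') where
  IsOpen O := ∀ g ∈ O, ∃ S : Set V, S.Finite ∧ ∀ u : T.almostPrescribed F F',
    (u : T.Aut) ∈ T.burgerMozes F → (∀ v ∈ S, (u : T.Aut) v = v) → g * u ∈ O
  isOpen_univ := fun _ _ => ⟨∅, Set.finite_empty, fun _ _ _ => trivial⟩
  isOpen_inter := fun O₁ O₂ h₁ h₂ g hg => by
    obtain ⟨S₁, hS₁, h₁⟩ := h₁ g hg.1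
    obtain ⟨S₂, hS₂, h₂⟩ := h₂ g hg.2
    exact ⟨S₁ ∪ S₂, hS₁.union hS₂, fun u hu hfix =>
      ⟨h₁ u hu fun v hv => hfix v (Or.inl hv), h₂ u hu fun v hv => hfix v (Or.inr hv)⟩⟩
  isOpen_sUnion := fun 𝒪 h g hg => by
    obtain ⟨O, hO, hgO⟩ := hg
    obtain ⟨S, hS, hSO⟩ := h O hO g hgO
    exact ⟨S, hS, fun u hu hfix => ⟨O, hO, hSO u hu hfix⟩⟩

/-- The type-preserving subgroup carries the subspace topology from `G(F, F')`. -/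
instance topologicalSpaceAlmostPrescribedStar (F F' : Subgroup (Equiv.Perm Ω)) :
    TopologicalSpace (T.almostPrescribedStar F F') :=
  TopologicalSpace.induced
    (Subgroup.inclusion (inf_le_left : T.almostPrescribedStar F F' ≤ T.almostPrescribed F F'))
    inferInstance

/-- The permutation topology on `U(F)`: pointwise convergence on the discrete set of vertices. -/
instance topologicalSpaceBurgerMozes (F : Subgroup (Equiv.Perm Ω)) :
    TopologicalSpace (T.burgerMozes F) :=
  TopologicalSpace.induced (fun g v => (g : T.Aut) v)
    (@Pi.topologicalSpace V (fun _ => V) fun _ => ⊥)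

theorem burgerMozes_le {F F' : Subgroup (Equiv.Perm Ω)} (h : F ≤ F') :
    T.burgerMozes F ≤ T.almostPrescribed F F' := fun g hg => by
  refine ⟨fun v => h (hg v), ?_⟩
  convert Set.finite_empty
  ext v
  simp [hg v]

/-- The topology on `G(F, F')` makes the inclusion of `U(F)`, with the permutation topology,
continuous and open. -/
theorem burgerMozes_inclusion {F F' : Subgroup (Equiv.Perm Ω)} (h : F ≤ F') :
    Continuous (Subgroup.inclusion (T.burgerMozes_le h)) ∧
      IsOpenMap (Subgroup.inclusion (T.burgerMozes_le h)) := by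
  let : TopologicalSpace V := ⊥
  have : DiscreteTopology V := ⟨rfl⟩
  have hind : Topology.IsInducing (fun (g : T.burgerMozes F) (v : V) => (g : T.Aut) v) := ⟨rfl⟩
  constructor
  · refine continuous_def.2 fun O hO => isOpen_iff_mem_nhds.2 fun g hg => ?_
    obtain ⟨S, hS, hSO⟩ := hO _ hg
    have hev : ∀ᶠ k : T.burgerMozes F in nhds g, ∀ v ∈ S, (k : T.Aut) v = (g : T.Aut) v := by
      refine (Filter.eventually_all_finite hS).2 fun v _ => ?_
      have hc : Continuous fun k : T.burgerMozes F => (k : T.Aut) v :=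
        (continuous_apply v).comp hind.continuous
      exact hc.continuousAt (IsOpen.mem_nhds (isOpen_discrete {(g : T.Aut) v}) rfl)
    refine Filter.mem_of_superset hev fun k hk => ?_
    have := hSO (Subgroup.inclusion (T.burgerMozes_le h) (g⁻¹ * k)) (g⁻¹ * k).2 fun v hv => by
      change (g : T.Aut)⁻¹ ((k : T.Aut) v) = v
      rw [hk v hv, RelIso.inv_apply_self]
    rw [← map_mul, mul_inv_cancel_left] at this
    exact this
  · rintro O hO _ ⟨g, hg, rfl⟩
    have hn := hO.mem_nhds hg
    rw [hind.nhds_eq_comap, Filter.mem_comap] at hn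
    obtain ⟨A, hA, hAO⟩ := hn
    rw [nhds_pi, Filter.mem_pi] at hA
    obtain ⟨S, hS, t, ht, htA⟩ := hA
    refine ⟨S, hS, fun u hu hfix => ⟨g * ⟨u, hu⟩, hAO (htA fun v hv => ?_), rfl⟩⟩
    change (g : T.Aut) ((u : T.Aut) v) ∈ t v
    rw [hfix v hv]
    exact mem_of_mem_nhds (ht v)

end ColoredTree

/-- The dihedral group `D_d` of order `2 * d` in its natural action on the `d` vertices of a
regular polygon, for `3 ≤ d`. -/
def dihedralPerm (d : ℕ) : Subgroup (Equiv.Perm (ZMod d)) where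
  carrier := {p | ∃ k : ZMod d, (∀ x, p x = k + x) ∨ (∀ x, p x = k - x)}
  one_mem' := ⟨0, Or.inl fun x => by simp⟩
  mul_mem' := by
    rintro p q ⟨k, hp | hp⟩ ⟨l, hq | hq⟩
    · exact ⟨k + l, Or.inl fun x => by rw [Equiv.Perm.mul_apply, hq, hp]; ring⟩
    · exact ⟨k + l, Or.inr fun x => by rw [Equiv.Perm.mul_apply, hq, hp]; ring⟩
    · exact ⟨k - l, Or.inr fun x => by rw [Equiv.Perm.mul_apply, hq, hp]; ring⟩
    · exact ⟨k - l, Or.inl fun x => by rw [Equiv.Perm.mul_apply, hq, hp]; ring⟩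
  inv_mem' := by
    rintro p ⟨k, hp | hp⟩
    · exact ⟨-k, Or.inl fun x => by rw [Equiv.Perm.inv_eq_iff_eq, hp]; ring⟩
    · exact ⟨k, Or.inr fun x => by rw [Equiv.Perm.inv_eq_iff_eq, hp]; ring⟩

section TopologicalGroups

variable {G : Type*} [Group G] [TopologicalSpace G]

/-- `G` is generated by a compact subset. -/
def IsCompactlyGeneratedGroup (G : Type*) [Group G] [TopologicalSpace G] : Prop :=
  ∃ K : Set G, IsCompact K ∧ Subgroup.closure K = ⊤

/-- `Γ` is a lattice in `G`: a discrete subgroup such that `G ⧸ Γ` carries a nonzero finite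
`G`-invariant regular Borel measure. -/
def IsLatticeSubgroup (Γ : Subgroup G) : Prop :=
  DiscreteTopology Γ ∧
    letI : MeasurableSpace (G ⧸ Γ) := borel (G ⧸ Γ)
    ∃ μ : Measure (G ⧸ Γ),
      μ ≠ 0 ∧ IsFiniteMeasure μ ∧ μ.Regular ∧ SMulInvariantMeasure G (G ⧸ Γ) μ

/-- `Γ` is a cocompact lattice in `G`. -/
def IsCocompactLattice (Γ : Subgroup G) : Prop :=
  IsLatticeSubgroup Γ ∧ CompactSpace (G ⧸ Γ)

/-- `G` is a (Hausdorff) locally compact group that is non-discrete, compactly generated and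
simple as an abstract group. -/
structure IsNondiscreteSimpleLCGroup (G : Type*) [Group G] [TopologicalSpace G] : Prop where
  isTopologicalGroup : IsTopologicalGroup G
  t2Space : T2Space G
  locallyCompactSpace : LocallyCompactSpace G
  nondiscrete : ¬ DiscreteTopology G
  compactlyGenerated : IsCompactlyGeneratedGroup G
  simple : IsSimpleGroup G

end TopologicalGroups

/-! An automorphism is determined by the image of one vertex and its local permutations. Conversely,
a field of local permutations comes from an automorphism as soon as the two ends of each edge agree
on the image of its colour (`exists_aut`). Everything is built from such fields, relative to a
simply transitive group `R ≤ F`. Writing `D` for the dihedral group, `R = D ∩ Alt` serves for both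
groups in question. The main elements are the rotations: `rotation w p` fixes `w`, acts there by
`p`, and has local permutations in `R` elsewhere. Together with the elements of `U(F)` supported in
a half-tree they generate `G(F, F')⋆` (`almostPrescribedStar_le`).

Simplicity (`almostPrescribedStar_le_of_normal`): a nontrivial element of a normal subgroup `N`
moves some half-tree off itself, and its conjugates do this for every half-tree. A double commutator
then puts in `N` all commutators of elements supported in a common half-tree. A three-cycle is a
commutator of even permutations with a common fixed point, so `N` contains the rotations by even
permutations, hence all of `G(R, R)⋆` and in particular the type-preserving colour-preserving
translations. An element of `U(F)` supported in a half-tree is a commutator involving such a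
translation, by an infinite product of disjointly supported translates (`exists_shift`), so it lies
in `N` too. Finally, each `p ∈ F'` is an even permutation times an element of `F` with a fixed
point.

Lattice: let `Γ = G(D ∩ Alt, Alt)⋆`, and let `K` be the fixator of an edge in `U(D)`, which is
compact and open in `G(D, Sym)⋆`. An element of `Γ ∩ K` has local permutations in `R` and fixes an
edge, so it is trivial. Point stabilizers in `D` contain both signs, so an element of `K` can be
chosen with any prescribed signs of local permutations; hence the whole group is `KΓ`. Simplicity
gives unimodularity, and Haar measure on `K` descends to an invariant measure on the quotient.

The congruence on `d` makes every reflection with a fixed point odd; this is what makes `D ∩ Alt`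
regular and provides both signs in point stabilizers. -/

namespace ColoredTree

variable {V Ω : Type*} (T : ColoredTree V Ω)

/-! ### Moving along colours; automorphisms as fields of local permutations -/

/-- The neighbour of `v` along the edge of colour `c`. -/
noncomputable def step (v : V) (c : Ω) : V := ((T.colorEquiv v).symm c : T.graph.neighborSet v)

theorem adj_step (v : V) (c : Ω) : T.graph.Adj v (T.step v c) :=
  ((T.colorEquiv v).symm c).2

theorem exists_step_eq {v w : V} (h : T.graph.Adj v w) : ∃ c, T.step v c = w :=
  ⟨T.colorEquiv v ⟨w, h⟩, by simp [step]⟩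

theorem color_step (v : V) (c : Ω) : T.color ⟨s(v, T.step v c), T.adj_step v c⟩ = c :=
  (T.colorEquiv v).apply_symm_apply c

theorem step_eq_of_color {v w : V} (h : T.graph.Adj v w) {c : Ω}
    (hc : T.color ⟨s(v, w), h⟩ = c) : T.step v c = w := by
  have : T.colorEquiv v ⟨w, h⟩ = c := hc
  simp [step, ← this]

theorem step_injective (v : V) : Function.Injective (T.step v) := fun _ _ h =>
  (T.colorEquiv v).symm.injective (Subtype.ext h)

@[simp]
theorem step_inj {v : V} {c c' : Ω} : T.step v c = T.step v c' ↔ c = c' :=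
  (T.step_injective v).eq_iff

@[simp]
theorem step_step (v : V) (c : Ω) : T.step (T.step v c) c = v := by
  refine T.step_eq_of_color (T.adj_step v c).symm ?_
  conv_rhs => rw [← T.color_step v c]
  congr 1
  exact Subtype.ext Sym2.eq_swap

theorem step_induction {p : V → Prop} (v₀ : V) (h₀ : p v₀)
    (hs : ∀ v c, p v → p (T.step v c)) (v : V) : p v := by
  obtain ⟨w⟩ := T.isTree.connected.preconnected v₀ v
  induction w with
  | nil => exact h₀
  | cons h _ ih =>
    obtain ⟨c, rfl⟩ := T.exists_step_eq h
    exact ih (hs _ c h₀)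

theorem map_step (g : T.Aut) (v : V) (c : Ω) :
    g (T.step v c) = T.step (g v) (T.localPerm g v c) := by
  simp [step, localPerm]

theorem localPerm_eq_iff (g : T.Aut) (v : V) (c e : Ω) :
    T.localPerm g v c = e ↔ g (T.step v c) = T.step (g v) e := by
  rw [map_step, step_inj]

/-- The image of an edge has one colour, whichever end it is read from. This is the only constraint
on a field of local permutations; see `exists_aut`. -/
theorem localPerm_step (g : T.Aut) (v : V) (c : Ω) :
    T.localPerm g (T.step v c) c = T.localPerm g v c := by
  rw [localPerm_eq_iff, step_step, map_step, step_step]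

theorem localPerm_congr {g h : T.Aut} {v : V} (h0 : g v = h v)
    (h1 : ∀ c, g (T.step v c) = h (T.step v c)) : T.localPerm g v = T.localPerm h v := by
  ext c
  rw [localPerm_eq_iff, h0, h1, map_step]

theorem localPerm_eq_one {g : T.Aut} {v : V} (h0 : g v = v)
    (h1 : ∀ c, g (T.step v c) = T.step v c) : T.localPerm g v = 1 := by
  rw [← T.localPerm_one v]
  exact T.localPerm_congr h0 h1

theorem aut_ext {g h : T.Aut} (v₀ : V) (h₀ : g v₀ = h v₀)
    (hs : ∀ v, T.localPerm g v = T.localPerm h v) : g = h :=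
  RelIso.ext fun v => T.step_induction v₀ (p := fun v => g v = h v) h₀
    (fun v c hv => by rw [map_step, map_step, hv, hs]) v

/-- Two automorphisms are equal if they agree at a vertex together with their local permutations
there, and if their local permutations are equal as soon as they agree at one colour. -/
theorem aut_ext_of_agree {g h : T.Aut} (v₀ : V) (h₀ : g v₀ = h v₀)
    (h₁ : T.localPerm g v₀ = T.localPerm h v₀)
    (hs : ∀ v, ∀ c, T.localPerm g v c = T.localPerm h v c → T.localPerm g v = T.localPerm h v) :
    g = h := by
  have key : ∀ v, g v = h v ∧ T.localPerm g v = T.localPerm h v := by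
    refine T.step_induction v₀ ⟨h₀, h₁⟩ ?_
    rintro v c ⟨h2, h3⟩
    refine ⟨by rw [map_step, map_step, h2, h3], hs _ c ?_⟩
    rw [localPerm_step, localPerm_step, h3]
  exact T.aut_ext v₀ h₀ fun v => (key v).2

/-! ### Distances and half-trees -/

theorem dist_step_right (u v : V) (c : Ω) :
    T.graph.dist u (T.step v c) = T.graph.dist u v + 1 ∨
      T.graph.dist u v = T.graph.dist u (T.step v c) + 1 := by
  have h1 := T.isTree.dist_ne_of_adj u (T.adj_step v c)
  have h2 := T.isTree.connected.dist_triangle (u := u) (v := v) (w := T.step v c)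
  have h3 := T.isTree.connected.dist_triangle (u := u) (v := T.step v c) (w := v)
  rw [SimpleGraph.dist_eq_one_iff_adj.2 (T.adj_step v c)] at h2
  rw [SimpleGraph.dist_eq_one_iff_adj.2 (T.adj_step v c).symm] at h3
  omega

theorem dist_step_left (u v : V) (c : Ω) :
    T.graph.dist (T.step u c) v = T.graph.dist u v + 1 ∨
      T.graph.dist u v = T.graph.dist (T.step u c) v + 1 := by
  rw [SimpleGraph.dist_comm, SimpleGraph.dist_comm (u := u)]
  exact T.dist_step_right v u c

theorem even_dist_step (u v : V) (c : Ω) :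
    Even (T.graph.dist u (T.step v c)) ↔ ¬ Even (T.graph.dist u v) := by
  rcases T.dist_step_right u v c with h | h <;> rw [h] <;> simp [Nat.even_add_one]

theorem even_dist_trans (u v w : V) :
    Even (T.graph.dist u w) ↔ (Even (T.graph.dist u v) ↔ Even (T.graph.dist v w)) := by
  refine T.step_induction v (p := fun w => Even (T.graph.dist u w) ↔
    (Even (T.graph.dist u v) ↔ Even (T.graph.dist v w))) (by simp) ?_ w
  intro w c h
  rw [even_dist_step, even_dist_step, h]
  tauto

theorem dist_map (g : T.Aut) (u v : V) : T.graph.dist (g u) (g v) = T.graph.dist u v := by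
  have key : ∀ (g : T.Aut) (u v : V), T.graph.dist (g u) (g v) ≤ T.graph.dist u v := by
    intro g u v
    obtain ⟨p, hp⟩ := T.isTree.connected.exists_walk_length_eq_dist u v
    rw [← hp, ← SimpleGraph.Walk.length_map g.toHom p]
    exact SimpleGraph.dist_le _
  refine le_antisymm (key g u v) ?_
  have := key g⁻¹ (g u) (g v)
  rwa [RelIso.inv_apply_self, RelIso.inv_apply_self] at this

theorem mem_typePreserving_iff (g : T.Aut) (v : V) :
    g ∈ T.typePreserving ↔ Even (T.graph.dist v (g v)) := by
  constructor
  · intro h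
    rw [h v v]
    simp
  · intro h u w
    rw [T.even_dist_trans u v (g w), T.even_dist_trans v (g v) (g w), dist_map,
      T.even_dist_trans u v w]
    tauto

theorem mem_typePreserving_of_fix {g : T.Aut} {v : V} (h : g v = v) : g ∈ T.typePreserving := by
  rw [T.mem_typePreserving_iff g v, h]
  simp

/-- The half-tree hanging off `u` along the edge of colour `c`: the vertices closer to the other
endpoint of that edge than to `u`. -/
def halfTree (u : V) (c : Ω) : Set V := {x | T.graph.dist (T.step u c) x < T.graph.dist u x}

theorem mem_halfTree {u x : V} {c : Ω} :
    x ∈ T.halfTree u c ↔ T.graph.dist u x = T.graph.dist (T.step u c) x + 1 := by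
  have := T.dist_step_left u x c
  simp only [halfTree, Set.mem_ofPred_eq]
  omega

theorem notMem_halfTree_self (u : V) (c : Ω) : u ∉ T.halfTree u c := by
  simp [mem_halfTree]

theorem step_mem_halfTree (u : V) (c : Ω) : T.step u c ∈ T.halfTree u c := by
  simp [mem_halfTree, SimpleGraph.dist_eq_one_iff_adj.2 (T.adj_step u c)]

theorem mem_halfTree_step {u x : V} {c : Ω} :
    x ∈ T.halfTree (T.step u c) c ↔ x ∉ T.halfTree u c := by
  have := T.dist_step_left u x c
  simp only [mem_halfTree, step_step]
  omega

theorem exists_mem_halfTree {u x : V} (h : x ≠ u) : ∃ c, x ∈ T.halfTree u c := by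
  obtain ⟨p, hp⟩ := T.isTree.connected.exists_walk_length_eq_dist u x
  cases p with
  | nil => exact absurd rfl h
  | cons hadj q =>
    obtain ⟨c, rfl⟩ := T.exists_step_eq hadj
    refine ⟨c, ?_⟩
    have := SimpleGraph.dist_le q
    simp only [SimpleGraph.Walk.length_cons] at hp
    simp only [halfTree, Set.mem_ofPred_eq]
    omega

/-- Each direction containing `x` is the first step of a geodesic from `u` to `x`, and paths in a
tree are unique. -/
theorem halfTree_unique {u x : V} {c c' : Ω} (h : x ∈ T.halfTree u c)
    (h' : x ∈ T.halfTree u c') : c = c' := by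
  have key : ∀ c, x ∈ T.halfTree u c → ∃ q : T.graph.Walk (T.step u c) x,
      (SimpleGraph.Walk.cons (T.adj_step u c) q).IsPath := by
    intro c h
    obtain ⟨q, hq⟩ := T.isTree.connected.exists_walk_length_eq_dist (T.step u c) x
    refine ⟨q, SimpleGraph.Walk.isPath_of_length_eq_dist _ ?_⟩
    rw [SimpleGraph.Walk.length_cons, hq, ← T.mem_halfTree.1 h]
  obtain ⟨q, hq⟩ := key c h
  obtain ⟨q', hq'⟩ := key c' h'
  have := (T.isTree.existsUnique_path u x).unique hq hq'
  have h3 := congrArg SimpleGraph.Walk.snd this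
  simpa using h3

theorem halfTree_subset {u : V} {b c : Ω} (h : b ≠ c) :
    T.halfTree (T.step u c) b ⊆ T.halfTree u c := by
  intro x hx
  by_contra hc
  exact h (T.halfTree_unique hx (T.mem_halfTree_step.2 hc))

/-- The only edge leaving a half-tree is the one it hangs off, so only this edge has to be checked
when fields of local permutations are glued. -/
theorem eq_of_mem_of_step_notMem {u x : V} {c e : Ω} (hx : x ∈ T.halfTree u c)
    (hy : T.step x e ∉ T.halfTree u c) : x = T.step u c ∧ e = c := by
  have h1 := T.mem_halfTree.1 hx
  have h2 := T.dist_step_left u (T.step x e) c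
  have h3 := mt T.mem_halfTree.2 hy
  have h4 := T.dist_step_right u x e
  have h5 := T.dist_step_right (T.step u c) x e
  have hxu : x = T.step u c := by
    by_contra hne
    obtain ⟨b, hb⟩ := T.exists_mem_halfTree (u := x) (x := T.step u c) (Ne.symm hne)
    have h6 := T.mem_halfTree.1 hb
    have h7 : u ∈ T.halfTree x b := by
      rw [mem_halfTree]
      have h8 := T.dist_step_left x u b
      have h9 := T.dist_step_right (T.step x b) u c
      simp only [SimpleGraph.dist_comm (u := x), SimpleGraph.dist_comm (u := T.step x b)] at *
      omega
    have h8 : u ∈ T.halfTree x e := by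
      rw [mem_halfTree, SimpleGraph.dist_comm, SimpleGraph.dist_comm (u := T.step x e)]
      omega
    have := T.halfTree_unique h7 h8
    subst this
    rw [SimpleGraph.dist_comm, SimpleGraph.dist_comm (u := T.step x b)] at h6
    omega
  subst hxu
  refine ⟨rfl, ?_⟩
  rw [SimpleGraph.dist_self] at h1 h5
  have : T.graph.dist u (T.step (T.step u c) e) = 0 := by omega
  have := (T.isTree.connected.dist_eq_zero_iff).1 this
  have h6 : T.step (T.step u c) c = T.step (T.step u c) e := by rw [step_step, ← this]
  exact (T.step_injective _ h6).symm

/-- Induction along the geodesic from `v` to `u`, where one step is `halfTree_subset`. -/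
theorem halfTree_mono {u v : V} {c e : Ω} (h1 : v ∉ T.halfTree u c) (h2 : u ∈ T.halfTree v e) :
    T.halfTree u c ⊆ T.halfTree v e := by
  induction hn : T.graph.dist v u generalizing v e with
  | zero =>
    rw [(T.isTree.connected.dist_eq_zero_iff).1 hn] at h2
    exact absurd h2 (T.notMem_halfTree_self u e)
  | succ n ih =>
    have h3 := T.mem_halfTree.1 h2
    have hvu : v ≠ u := by
      rintro rfl
      exact T.notMem_halfTree_self _ _ h2
    by_cases hu : u = T.step v e
    · have hec : c ≠ e := by
        rintro rfl
        apply h1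
        rw [hu, mem_halfTree_step]
        exact T.notMem_halfTree_self v c
      rw [hu]
      exact T.halfTree_subset hec
    · obtain ⟨b, hb⟩ := T.exists_mem_halfTree hu
      have hbe : b ≠ e := by
        rintro rfl
        exact (T.mem_halfTree_step.1 hb) h2
      have h4 : T.step v e ∉ T.halfTree u c := by
        intro h4
        have := T.eq_of_mem_of_step_notMem h4 (e := e) (by rwa [step_step])
        apply hvu
        have h6 := this.1
        rw [this.2] at h6
        simpa using congrArg (fun y => T.step y c) h6
      exact (ih h4 hb (by omega)).trans (T.halfTree_subset hbe)

theorem disjoint_halfTree {u v : V} {c e : Ω} (huv : u ≠ v) (h1 : v ∉ T.halfTree u c)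
    (h2 : u ∉ T.halfTree v e) : Disjoint (T.halfTree u c) (T.halfTree v e) := by
  obtain ⟨b, hb⟩ := T.exists_mem_halfTree huv
  refine Set.disjoint_left.2 fun x hx hx' => h2 ?_
  rwa [T.halfTree_unique hx' (T.halfTree_mono h1 hb hx)]

theorem map_mem_halfTree (g : T.Aut) {u x : V} {c : Ω} :
    g x ∈ T.halfTree (g u) (T.localPerm g u c) ↔ x ∈ T.halfTree u c := by
  rw [mem_halfTree, mem_halfTree, ← map_step, dist_map, dist_map]

/-! ### Automorphisms with prescribed local permutations -/

/-- The colour at `u` of the edge pointing towards `x`. -/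
noncomputable def toward (u x : V) (h : x ≠ u) : Ω := (T.exists_mem_halfTree h).choose

theorem toward_spec {u x : V} (h : x ≠ u) : x ∈ T.halfTree u (T.toward u x h) :=
  (T.exists_mem_halfTree h).choose_spec

theorem toward_eq {u x : V} {c : Ω} (h : x ≠ u) (hc : x ∈ T.halfTree u c) :
    T.toward u x h = c := T.halfTree_unique (T.toward_spec h) hc

theorem dist_toward_lt {v₀ v : V} (h : v₀ ≠ v) :
    T.graph.dist v₀ (T.step v (T.toward v v₀ h)) < T.graph.dist v₀ v := by
  rw [SimpleGraph.dist_comm, SimpleGraph.dist_comm (u := v₀)]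
  exact T.toward_spec h

open Classical in
/-- Recursion along the rooted tree: the value at a vertex is computed from the value at its
neighbour in the direction of the root and the colour of the edge between them. -/
noncomputable def treeRec {β : Type*} (v₀ : V) (b₀ : β) (f : V → Ω → β → β) (v : V) : β :=
  if h : v₀ = v then b₀
  else f v (T.toward v v₀ h) (treeRec v₀ b₀ f (T.step v (T.toward v v₀ h)))
termination_by T.graph.dist v₀ v
decreasing_by exact T.dist_toward_lt h

theorem treeRec_root {β : Type*} (v₀ : V) (b₀ : β) (f : V → Ω → β → β) :
    T.treeRec v₀ b₀ f v₀ = b₀ := by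
  rw [treeRec]
  simp

theorem treeRec_step {β : Type*} {v₀ : V} (b₀ : β) (f : V → Ω → β → β) {v : V} {c : Ω}
    (h : v₀ ∉ T.halfTree v c) :
    T.treeRec v₀ b₀ f (T.step v c) = f (T.step v c) c (T.treeRec v₀ b₀ f v) := by
  have h1 := T.mem_halfTree_step.2 h
  have h2 : v₀ ≠ T.step v c := by
    intro h2
    rw [← h2] at h1
    exact T.notMem_halfTree_self _ _ h1
  rw [treeRec, dif_neg h2]
  congr 1
  · exact T.toward_eq h2 h1
  · rw [T.toward_eq h2 h1, step_step]

/-- Injectivity: compatibility forces `g` to send half-trees into half-trees, so a vertex is kept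
apart from any other. Surjectivity: the image is closed under taking neighbours. -/
theorem bijective_of_step {g : V → V} {s : V → Equiv.Perm Ω}
    (hs : ∀ v c, s (T.step v c) c = s v c)
    (hg : ∀ v c, g (T.step v c) = T.step (g v) (s v c)) : Function.Bijective g := by
  have key : ∀ n x y c, T.graph.dist x y = n → y ∈ T.halfTree x c →
      g y ∈ T.halfTree (g x) (s x c) := by
    intro n
    induction n with
    | zero =>
      intro x y c h hy
      rw [mem_halfTree] at hy
      omega
    | succ n ih =>
      intro x y c h hy
      have h1 := T.mem_halfTree.1 hy
      by_cases hyx : y = T.step x c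
      · rw [hyx, hg]
        exact T.step_mem_halfTree _ _
      · obtain ⟨b, hb⟩ := T.exists_mem_halfTree hyx
        have hbc : b ≠ c := by
          rintro rfl
          exact (T.mem_halfTree_step.1 hb) hy
        have h2 := ih _ _ _ (by omega) hb
        rw [hg] at h2
        refine T.halfTree_subset ?_ h2
        rw [← hs x c]
        exact fun h => hbc ((s _).injective h)
  constructor
  · intro x y hxy
    by_contra hne
    obtain ⟨c, hc⟩ := T.exists_mem_halfTree (Ne.symm hne)
    have := key _ _ _ _ rfl hc
    rw [hxy] at this
    exact T.notMem_halfTree_self _ _ this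
  · obtain ⟨v₀⟩ := T.isTree.connected.nonempty
    refine T.step_induction (g v₀) ⟨v₀, rfl⟩ ?_
    rintro _ c ⟨x, rfl⟩
    exact ⟨T.step x ((s x)⁻¹ c), by rw [hg]; simp⟩

theorem exists_aut (v₀ v₁ : V) (s : V → Equiv.Perm Ω)
    (hs : ∀ v c, s (T.step v c) c = s v c) :
    ∃ g : T.Aut, g v₀ = v₁ ∧ ∀ v, T.localPerm g v = s v := by
  let g : V → V := T.treeRec v₀ v₁ fun v c z => T.step z (s v c)
  have hg : ∀ v c, g (T.step v c) = T.step (g v) (s v c) := by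
    intro v c
    by_cases h : v₀ ∈ T.halfTree v c
    · have h1 := T.treeRec_step v₁ (fun v c z => T.step z (s v c)) (v := T.step v c) (c := c)
        (v₀ := v₀) (by rwa [mem_halfTree_step, not_not])
      rw [step_step] at h1
      change g v = T.step (g (T.step v c)) (s v c) at h1
      rw [h1, step_step]
    · have h1 := T.treeRec_step v₁ (fun v c z => T.step z (s v c)) h
      change g _ = T.step (g v) (s (T.step v c) c) at h1
      rw [h1, hs]
  have hb := T.bijective_of_step hs hg
  have hadj : ∀ {u v}, T.graph.Adj (g u) (g v) ↔ T.graph.Adj u v := by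
    intro u v
    constructor
    · intro h
      obtain ⟨e, he⟩ := T.exists_step_eq h
      have : v = T.step u ((s u)⁻¹ e) := hb.1 (by rw [hg, ← he]; simp)
      rw [this]
      exact T.adj_step _ _
    · intro h
      obtain ⟨c, rfl⟩ := T.exists_step_eq h
      rw [hg]
      exact T.adj_step _ _
  refine ⟨⟨Equiv.ofBijective g hb, hadj⟩, T.treeRec_root _ _ _, fun v => ?_⟩
  ext c
  rw [localPerm_eq_iff]
  exact hg v c

/-- Going outwards from the root, a new vertex is constrained only at the colour of the edge to its
predecessor, and transitivity of `A v` meets this single condition. -/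
theorem exists_aut_localPerm_mem (v₀ v₁ : V) (A : V → Set (Equiv.Perm Ω))
    (hA : ∀ v a b, ∃ p ∈ A v, p a = b) (a₀ b₀ : Ω) :
    ∃ g : T.Aut, g v₀ = v₁ ∧ T.localPerm g v₀ a₀ = b₀ ∧ ∀ v, T.localPerm g v ∈ A v := by
  choose P hP hPa using hA
  let s : V → Equiv.Perm Ω := T.treeRec v₀ (P v₀ a₀ b₀) fun v c p => P v c (p c)
  have hs : ∀ v c, s (T.step v c) c = s v c := by
    intro v c
    by_cases h : v₀ ∈ T.halfTree v c
    · have h1 := T.treeRec_step (P v₀ a₀ b₀) (fun v c p => P v c (p c)) (v := T.step v c) (c := c)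
        (v₀ := v₀) (by rwa [mem_halfTree_step, not_not])
      rw [step_step] at h1
      change s v = P v c (s (T.step v c) c) at h1
      rw [h1, hPa]
    · have h1 := T.treeRec_step (P v₀ a₀ b₀) (fun v c p => P v c (p c)) h
      change s _ = P (T.step v c) c (s v c) at h1
      rw [h1, hPa]
  obtain ⟨g, hg, hgs⟩ := T.exists_aut v₀ v₁ s hs
  have hroot : s v₀ = P v₀ a₀ b₀ := T.treeRec_root _ _ _
  refine ⟨g, hg, by rw [hgs, hroot, hPa], fun v => ?_⟩
  rw [hgs]
  by_cases h : v₀ = v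
  · rw [← h, hroot]
    exact hP _ _ _
  · have h1 := T.treeRec_step (P v₀ a₀ b₀) (fun v c p => P v c (p c))
      (v := T.step v (T.toward v v₀ h)) (c := T.toward v v₀ h) (v₀ := v₀)
      (by rw [mem_halfTree_step, not_not]; exact T.toward_spec h)
    rw [step_step] at h1
    change s v = _ at h1
    rw [h1]
    exact hP _ _ _

end ColoredTree

/-- A permutation group that acts simply transitively. -/
structure IsRegularPermGroup {Ω : Type*} (R : Subgroup (Equiv.Perm Ω)) : Prop where
  trans : ∀ a b, ∃ r ∈ R, r a = b
  free : ∀ r ∈ R, ∀ a, r a = a → r = 1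

theorem IsRegularPermGroup.eq_of_apply_eq {Ω : Type*} {R : Subgroup (Equiv.Perm Ω)}
    (hR : IsRegularPermGroup R) {r s : Equiv.Perm Ω} (hr : r ∈ R) (hs : s ∈ R) {a : Ω}
    (h : r a = s a) : r = s := by
  have := hR.free (s⁻¹ * r) (R.mul_mem (R.inv_mem hs) hr) a (by simp [h])
  exact (inv_mul_eq_one.1 this).symm

namespace ColoredTree

variable {V Ω : Type*} (T : ColoredTree V Ω)

/-! ### Gluing along an edge -/

theorem eqOn_halfTree {g h : T.Aut} {u : V} {c : Ω} (h₀ : g (T.step u c) = h (T.step u c))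
    (hs : ∀ x ∈ T.halfTree u c, T.localPerm g x = T.localPerm h x) :
    ∀ x ∈ T.halfTree u c, g x = h x := by
  refine T.step_induction (T.step u c) (fun _ => h₀) ?_
  intro v e ih hve
  by_cases hv : v ∈ T.halfTree u c
  · rw [map_step, map_step, ih hv, hs v hv]
  · rw [(T.eq_of_mem_of_step_notMem hve (e := e) (by rwa [step_step])).1, h₀]

/-- Tits' independence property. Since `g` fixes the edge, it fixes the colour `c` at both ends, so
its local permutations can be replaced by `1` on one side without breaking compatibility. -/
theorem exists_restrict {g : T.Aut} {u : V} {c : Ω} (hu : g u = u)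
    (hc : g (T.step u c) = T.step u c) :
    ∃ h : T.Aut, (∀ x ∈ T.halfTree u c, h x = g x) ∧ (∀ x ∉ T.halfTree u c, h x = x) ∧
      (∀ x ∈ T.halfTree u c, T.localPerm h x = T.localPerm g x) ∧
      ∀ x ∉ T.halfTree u c, T.localPerm h x = 1 := by
  classical
  let s : V → Equiv.Perm Ω := fun x => if x ∈ T.halfTree u c then T.localPerm g x else 1
  have hgc : T.localPerm g (T.step u c) c = c := by
    rw [localPerm_eq_iff, step_step, hc, step_step, hu]
  have hgc' : T.localPerm g u c = c := by rw [localPerm_eq_iff, hc, hu]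
  have hs : ∀ v e, s (T.step v e) e = s v e := by
    intro v e
    by_cases h1 : v ∈ T.halfTree u c <;> by_cases h2 : T.step v e ∈ T.halfTree u c <;>
      simp only [s, h1, h2, if_true, if_false]
    · exact T.localPerm_step g v e
    · obtain ⟨rfl, rfl⟩ := T.eq_of_mem_of_step_notMem h1 h2
      rw [hgc]
      rfl
    · obtain ⟨h3, rfl⟩ := T.eq_of_mem_of_step_notMem h2 (e := e) (by rwa [step_step])
      rw [h3, hgc]
      rfl
  obtain ⟨h, hhu, hhs⟩ := T.exists_aut u u s hs
  have hin : ∀ x ∈ T.halfTree u c, T.localPerm h x = T.localPerm g x := fun x hx => by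
    rw [hhs]
    simp only [s, hx, if_true]
  have hout : ∀ x ∉ T.halfTree u c, T.localPerm h x = 1 := fun x hx => by
    rw [hhs]
    simp only [s, hx, if_false]
  refine ⟨h, T.eqOn_halfTree ?_ hin, ?_, hin, hout⟩
  · rw [map_step, hhu, hout u (T.notMem_halfTree_self u c), hc]
    rfl
  · intro x hx
    refine T.eqOn_halfTree (g := h) (h := 1) (u := T.step u c) (c := c) ?_ ?_ x
      (T.mem_halfTree_step.2 hx)
    · rw [step_step, hhu]
      rfl
    · intro y hy
      rw [hout y (T.mem_halfTree_step.1 hy), localPerm_one]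

/-! ### Rotations around a vertex -/

section Rotation

variable {R : Subgroup (Equiv.Perm Ω)} (hR : IsRegularPermGroup R)

theorem exists_rotation (hR : IsRegularPermGroup R) (w : V) (p : Equiv.Perm Ω) :
    ∃ g : T.Aut, g w = w ∧ T.localPerm g w = p ∧
      (∀ x, x ≠ w → T.localPerm g x ∈ R) ∧
      ∀ c, ∀ x ∈ T.halfTree w c, T.localPerm g x c = p c := by
  classical
  choose r hr hra using hR.trans
  -- On the half-tree in direction `c` the field is constantly the element of `R` taking `c` to `p
  -- c`, which matches `p` across the edge at `w`.
  let s : V → Equiv.Perm Ω := fun x =>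
    if h : x = w then p else r (T.toward w x h) (p (T.toward w x h))
  have hsw : s w = p := by simp [s]
  have hsc : ∀ c, ∀ x ∈ T.halfTree w c, s x = r c (p c) := by
    intro c x hx
    have hxw : x ≠ w := by
      rintro rfl
      exact T.notMem_halfTree_self _ _ hx
    simp only [s, dif_neg hxw, T.toward_eq hxw hx]
  have hs : ∀ v e, s (T.step v e) e = s v e := by
    intro v e
    by_cases hv : v = w
    · subst hv
      rw [hsc e _ (T.step_mem_halfTree v e), hra, hsw]
    · obtain ⟨c, hc⟩ := T.exists_mem_halfTree hv
      by_cases hve : T.step v e ∈ T.halfTree w c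
      · rw [hsc c _ hc, hsc c _ hve]
      · obtain ⟨rfl, rfl⟩ := T.eq_of_mem_of_step_notMem hc hve
        rw [step_step, hsw, hsc e _ hc, hra]
  obtain ⟨g, hg, hgs⟩ := T.exists_aut w w s hs
  refine ⟨g, hg, by rw [hgs, hsw], fun x hx => ?_, fun c x hx => ?_⟩
  · obtain ⟨c, hc⟩ := T.exists_mem_halfTree hx
    rw [hgs, hsc c x hc]
    exact hr _ _
  · rw [hgs, hsc c x hx, hra]

/-- The automorphism fixing `w` with local permutation `p` at `w` and whose local permutations
elsewhere lie in the regular group `R`. -/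
noncomputable def rotation (w : V) (p : Equiv.Perm Ω) : T.Aut :=
  (T.exists_rotation hR w p).choose

theorem rotation_self (w : V) (p : Equiv.Perm Ω) : T.rotation hR w p w = w :=
  (T.exists_rotation hR w p).choose_spec.1

theorem localPerm_rotation_self (w : V) (p : Equiv.Perm Ω) :
    T.localPerm (T.rotation hR w p) w = p :=
  (T.exists_rotation hR w p).choose_spec.2.1

theorem localPerm_rotation_mem {w x : V} (p : Equiv.Perm Ω) (h : x ≠ w) :
    T.localPerm (T.rotation hR w p) x ∈ R :=
  (T.exists_rotation hR w p).choose_spec.2.2.1 x h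

theorem rotation_step (w : V) (p : Equiv.Perm Ω) (c : Ω) :
    T.rotation hR w p (T.step w c) = T.step w (p c) := by
  rw [map_step, rotation_self, localPerm_rotation_self]

/-- In direction `a` the local permutations lie in `R` and fix `a`, so they are trivial by freeness.
-/
theorem rotation_apply_of_mem {w x : V} {p : Equiv.Perm Ω} {a : Ω} (hp : p a = a)
    (hx : x ∈ T.halfTree w a) : T.rotation hR w p x = x := by
  refine T.eqOn_halfTree (h := 1) ?_ ?_ x hx
  · rw [rotation_step, hp]
    rfl
  · intro y hy
    rw [localPerm_one]
    refine hR.free _ (T.localPerm_rotation_mem hR p ?_) a ?_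
    · rintro rfl
      exact T.notMem_halfTree_self _ _ hy
    · exact ((T.exists_rotation hR w p).choose_spec.2.2.2 a y hy).trans hp

theorem rotation_apply_of_notMem {w x : V} {p : Equiv.Perm Ω} {a : Ω} (hp : p a = a)
    (hx : x ∉ T.halfTree (T.step w a) a) : T.rotation hR w p x = x :=
  T.rotation_apply_of_mem hR hp (by rwa [mem_halfTree_step, not_not] at hx)

/-- Away from `w`, an element of `R` is determined by its value at the colour leading back to `w`.
This uniqueness makes rotations multiplicative and compatible with conjugation by translations. -/
theorem eq_rotation {g : T.Aut} {w : V} {p : Equiv.Perm Ω} (hw : g w = w)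
    (hp : T.localPerm g w = p) (hg : ∀ x, x ≠ w → T.localPerm g x ∈ R) :
    g = T.rotation hR w p := by
  refine T.aut_ext_of_agree w ?_ ?_ ?_
  · rw [hw, rotation_self]
  · rw [hp, localPerm_rotation_self]
  · intro v c hc
    by_cases hv : v = w
    · rw [hv, hp, localPerm_rotation_self]
    · exact hR.eq_of_apply_eq (hg v hv) (T.localPerm_rotation_mem hR p hv) hc

theorem rotation_mul (w : V) (p q : Equiv.Perm Ω) :
    T.rotation hR w (p * q) = T.rotation hR w p * T.rotation hR w q := by
  refine (T.eq_rotation hR ?_ ?_ ?_).symm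
  · rw [RelIso.mul_apply, rotation_self, rotation_self]
  · rw [localPerm_mul, rotation_self, localPerm_rotation_self, localPerm_rotation_self]
  · intro x hx
    rw [localPerm_mul]
    refine R.mul_mem (T.localPerm_rotation_mem hR p ?_) (T.localPerm_rotation_mem hR q hx)
    intro h
    refine hx ((T.rotation hR w q).injective ?_)
    rw [h, rotation_self]

/-- The rotations around `w` form a copy of the symmetric group. -/
noncomputable def rotationHom (w : V) : Equiv.Perm Ω →* T.Aut :=
  MonoidHom.mk' (T.rotation hR w) (T.rotation_mul hR w)

@[simp]
theorem rotationHom_apply (w : V) (p : Equiv.Perm Ω) :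
    T.rotationHom hR w p = T.rotation hR w p := rfl

theorem rotation_conj {t : T.Aut} (ht : ∀ v, T.localPerm t v = 1) (w : V) (p : Equiv.Perm Ω) :
    t * T.rotation hR w p * t⁻¹ = T.rotation hR (t w) p := by
  refine T.eq_rotation hR ?_ ?_ ?_
  · simp [RelIso.mul_apply, RelIso.inv_apply_self, rotation_self]
  · simp [localPerm_mul, localPerm_inv, ht, RelIso.inv_apply_self, localPerm_rotation_self]
  · intro x hx
    simp only [localPerm_mul, localPerm_inv, ht, inv_one, mul_one, one_mul]
    refine T.localPerm_rotation_mem hR p ?_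
    intro h
    exact hx (by rw [← h, RelIso.apply_inv_self])

theorem rotation_mem_star {F F' : Subgroup (Equiv.Perm Ω)} (hRF : R ≤ F) (hFF' : F ≤ F') (w : V)
    {p : Equiv.Perm Ω} (hp : p ∈ F') : T.rotation hR w p ∈ T.almostPrescribedStar F F' := by
  refine ⟨⟨fun v => ?_, (Set.finite_singleton w).subset fun v hv => ?_⟩,
    T.mem_typePreserving_of_fix (T.rotation_self hR w p)⟩
  · by_cases hv : v = w
    · rwa [hv, localPerm_rotation_self]
    · exact hFF' (hRF (T.localPerm_rotation_mem hR p hv))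
  · by_contra h
    exact hv (hRF (T.localPerm_rotation_mem hR p h))

theorem rotation_mem_burgerMozes {F : Subgroup (Equiv.Perm Ω)} (hRF : R ≤ F) (w : V)
    {p : Equiv.Perm Ω} (hp : p ∈ F) : T.rotation hR w p ∈ T.burgerMozes F := by
  intro v
  by_cases hv : v = w
  · rwa [hv, localPerm_rotation_self]
  · exact hRF (T.localPerm_rotation_mem hR p hv)

/-- Conjugates of the rotations about the two ends of one edge carry any vertex already reached to
all of its neighbours. -/
theorem exists_apply_eq_or {L : Subgroup T.Aut} {v₀ : V} {c₀ : Ω}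
    (h₀ : ∀ r ∈ R, T.rotation hR v₀ r ∈ L)
    (h₁ : ∀ r ∈ R, T.rotation hR (T.step v₀ c₀) r ∈ L) (x : V) :
    ∃ l ∈ L, l ∈ T.burgerMozes R ∧ l ∈ T.typePreserving ∧ (l v₀ = x ∨ l (T.step v₀ c₀) = x) := by
  refine T.step_induction (p := fun x => ∃ l ∈ L, l ∈ T.burgerMozes R ∧ l ∈ T.typePreserving ∧
    (l v₀ = x ∨ l (T.step v₀ c₀) = x)) v₀ ⟨1, L.one_mem, one_mem _, one_mem _, Or.inl rfl⟩ ?_ x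
  rintro _ c ⟨l, hl, hlR, hlt, rfl | rfl⟩
  · obtain ⟨r, hr, hrc⟩ := hR.trans c₀ ((T.localPerm l v₀)⁻¹ c)
    refine ⟨l * T.rotation hR v₀ r, L.mul_mem hl (h₀ r hr),
      mul_mem hlR (T.rotation_mem_burgerMozes hR le_rfl v₀ hr),
      mul_mem hlt (T.mem_typePreserving_of_fix (T.rotation_self hR v₀ r)), Or.inr ?_⟩
    rw [RelIso.mul_apply, rotation_step, map_step, hrc]
    simp
  · obtain ⟨r, hr, hrc⟩ := hR.trans c₀ ((T.localPerm l (T.step v₀ c₀))⁻¹ c)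
    refine ⟨l * T.rotation hR (T.step v₀ c₀) r, L.mul_mem hl (h₁ r hr),
      mul_mem hlR (T.rotation_mem_burgerMozes hR le_rfl _ hr),
      mul_mem hlt (T.mem_typePreserving_of_fix (T.rotation_self hR _ r)), Or.inl ?_⟩
    have h := T.rotation_step hR (T.step v₀ c₀) r c₀
    rw [step_step] at h
    rw [RelIso.mul_apply, h, map_step, hrc]
    simp

theorem exists_apply_eq {L : Subgroup T.Aut} {v₀ : V} {c₀ : Ω}
    (h₀ : ∀ r ∈ R, T.rotation hR v₀ r ∈ L)
    (h₁ : ∀ r ∈ R, T.rotation hR (T.step v₀ c₀) r ∈ L) {x : V}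
    (hx : Even (T.graph.dist v₀ x)) :
    ∃ l ∈ L, l ∈ T.burgerMozes R ∧ l ∈ T.typePreserving ∧ l v₀ = x := by
  obtain ⟨l, hl, hlR, hlt, rfl | rfl⟩ := T.exists_apply_eq_or hR h₀ h₁ x
  · exact ⟨l, hl, hlR, hlt, rfl⟩
  · rw [hlt, even_dist_step] at hx
    simp at hx

end Rotation

/-! ### Generation -/

/-- By independence, `g` is a product of two elements of `U(F)`, one supported on each side of the
fixed edge. -/
theorem mem_of_fix_edge {F : Subgroup (Equiv.Perm Ω)} {L : Subgroup T.Aut}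
    (hB : ∀ u c, ∀ b ∈ T.burgerMozes F, (∀ x ∉ T.halfTree u c, b x = x) → b ∈ L)
    {g : T.Aut} (hg : g ∈ T.burgerMozes F) {u : V} {c : Ω} (hu : g u = u)
    (hc : g (T.step u c) = T.step u c) : g ∈ L := by
  obtain ⟨h, h1, h2, h3, h4⟩ := T.exists_restrict hu hc
  have hh : h ∈ T.burgerMozes F := by
    intro x
    by_cases hx : x ∈ T.halfTree u c
    · rw [h3 x hx]
      exact hg x
    · rw [h4 x hx]
      exact F.one_mem
  have h5 : h⁻¹ * g ∈ L := by
    refine hB (T.step u c) c _ (mul_mem (inv_mem hh) hg) fun x hx => ?_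
    rw [mem_halfTree_step, not_not] at hx
    rw [RelIso.mul_apply, ← h1 x hx, RelIso.inv_apply_self]
  have := L.mul_mem (hB u c h hh h2) h5
  rwa [mul_inv_cancel_left] at this

theorem almostPrescribedStar_le {R F F' : Subgroup (Equiv.Perm Ω)} (hR : IsRegularPermGroup R)
    (hRF : R ≤ F) (hFF' : F ≤ F') [Nonempty Ω] {L : Subgroup T.Aut}
    (hL : ∀ w, ∀ p ∈ F', T.rotation hR w p ∈ L)
    (hB : ∀ u c, ∀ b ∈ T.burgerMozes F, (∀ x ∉ T.halfTree u c, b x = x) → b ∈ L) :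
    T.almostPrescribedStar F F' ≤ L := by
  -- Without singularities: bring `v₀` back by a product of rotations, then undo the local
  -- permutation there by one more rotation; the rest fixes an edge.
  have hbase : ∀ g ∈ T.burgerMozes F, g ∈ T.typePreserving → g ∈ L := by
    intro g hg hgt
    obtain ⟨v₀⟩ := T.isTree.connected.nonempty
    obtain ⟨c₀⟩ := ‹Nonempty Ω›
    have hRF' := hRF.trans hFF'
    obtain ⟨l, hl, hlR, -, hlg⟩ := T.exists_apply_eq hR (L := L) (c₀ := c₀)
      (fun r hr => hL v₀ r (hRF' hr)) (fun r hr => hL _ r (hRF' hr))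
      ((T.mem_typePreserving_iff g v₀).1 hgt)
    have hlF : l ∈ T.burgerMozes F := fun v => hRF (hlR v)
    have h1 : (l⁻¹ * g) v₀ = v₀ := by rw [RelIso.mul_apply, ← hlg, RelIso.inv_apply_self]
    have h2 : l⁻¹ * g ∈ T.burgerMozes F := mul_mem (inv_mem hlF) hg
    set k := l⁻¹ * g with hk
    set q := T.rotation hR v₀ (T.localPerm k v₀) with hq
    have h3 : q⁻¹ * k ∈ L := by
      refine T.mem_of_fix_edge hB (u := v₀) (c := c₀) (mul_mem (inv_mem
        (T.rotation_mem_burgerMozes hR hRF v₀ (h2 v₀))) h2) ?_ ?_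
      · rw [RelIso.mul_apply, h1]
        conv_lhs => rw [← T.rotation_self hR v₀ (T.localPerm k v₀)]
        exact RelIso.inv_apply_self _ _
      · rw [RelIso.mul_apply, map_step, h1, ← T.rotation_step hR]
        exact RelIso.inv_apply_self _ _
    have h4 := L.mul_mem (hL v₀ _ (hFF' (h2 v₀))) h3
    rw [mul_inv_cancel_left] at h4
    have h5 := L.mul_mem hl h4
    rwa [hk, mul_inv_cancel_left] at h5
  intro g hg
  induction hn : {v | T.localPerm g v ∉ F}.ncard using Nat.strong_induction_on generalizing g with
  | _ n ih =>
    by_cases hF : g ∈ T.burgerMozes F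
    · exact hbase g hF hg.2
    · obtain ⟨x, hx⟩ : ∃ x, T.localPerm g x ∉ F := by
        by_contra! h
        exact hF h
      -- This rotation repairs the singularity `x`. Its other local permutations lie in `R ≤ F`, so
      -- it maps the singularities of `g * q` injectively to those of `g` other than `x`.
      set q := T.rotation hR x (T.localPerm g x)⁻¹ with hq
      have hpF' : (T.localPerm g x)⁻¹ ∈ F' := F'.inv_mem (hg.1.1 x)
      have hqm : q ∈ T.almostPrescribedStar F F' := T.rotation_mem_star hR hRF hFF' x hpF'
      have hmaps : Set.MapsTo q {v | T.localPerm (g * q) v ∉ F}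
          ({v | T.localPerm g v ∉ F} \ {x}) := by
        intro y hy
        have hyx : y ≠ x := by
          rintro rfl
          apply hy
          rw [localPerm_mul, hq, rotation_self, localPerm_rotation_self, mul_inv_cancel]
          exact F.one_mem
        refine ⟨fun h => hy ?_, fun h => hyx (q.injective ?_)⟩
        · rw [localPerm_mul]
          exact F.mul_mem h (hRF (T.localPerm_rotation_mem hR _ hyx))
        · rw [hq, rotation_self]
          exact h
      have hlt : {v | T.localPerm (g * q) v ∉ F}.ncard < n := by
        have h1 := Set.ncard_le_ncard_of_injOn q hmaps q.injective.injOn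
          (hg.1.2.subset Set.sdiff_subset)
        have h2 := Set.ncard_sdiff_singleton_lt_of_mem (s := {v | T.localPerm g v ∉ F}) hx hg.1.2
        omega
      have h3 := L.mul_mem (ih _ hlt (mul_mem hg hqm) rfl) (L.inv_mem (hL x _ hpF'))
      rwa [mul_inv_cancel_right] at h3

end ColoredTree

/-! ### Three-cycles as commutators -/

/-- On at least six points, a three-cycle is a commutator of even permutations with a common
fixed point. -/
theorem Equiv.Perm.IsThreeCycle.exists_commutator_eq {Ω : Type*} [Fintype Ω] [DecidableEq Ω]
    (h6 : 6 ≤ Fintype.card Ω) {q : Equiv.Perm Ω} (hq : q.IsThreeCycle) :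
    ∃ (a : Ω) (s : Equiv.Perm Ω), s ∈ alternatingGroup Ω ∧ s a = a ∧ q a = a ∧
      s * q * s⁻¹ * q⁻¹ = q := by
  have hcard : 2 < (q.support)ᶜ.card := by
    rw [Finset.card_compl, hq.card_support]
    omega
  obtain ⟨a, ha, l, hl, m, hm, hal, ham, hlm⟩ := Finset.two_lt_card.1 hcard
  obtain ⟨i, hi⟩ := hq.isCycle.nonempty_support
  have hsupp := hq.support_eq_iff_mem_support.2 hi
  have hnd := hq.nodup_iff_mem_support.2 hi
  have hqs := hq.eq_swap_mul_swap_iff_mem_support.2 hi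
  have hqa : q a = a := by simpa using ha
  generalize q i = j at *
  generalize q j = k at *
  simp only [List.nodup_cons, List.mem_cons, List.not_mem_nil, or_false, not_or,
    List.nodup_nil, not_false_eq_true, and_true] at hnd
  obtain ⟨⟨hij, hik⟩, hjk⟩ := hnd
  simp only [hsupp, Finset.mem_compl, Finset.mem_insert, Finset.mem_singleton, not_or] at ha hl hm
  -- Swapping `j` and `k` inverts `q = (i j k)`, so the commutator is `q⁻² = q`; the swap of `l` and
  -- `m` only corrects the sign, and `a` is the sixth point.
  refine ⟨a, Equiv.swap j k * Equiv.swap l m, ?_, ?_, hqa, ?_⟩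
  · rw [Equiv.Perm.mem_alternatingGroup, map_mul, Equiv.Perm.sign_swap hjk,
      Equiv.Perm.sign_swap hlm]
    rfl
  · rw [Equiv.Perm.mul_apply, Equiv.swap_apply_of_ne_of_ne hal ham,
      Equiv.swap_apply_of_ne_of_ne ha.2.1 ha.2.2]
  · rw [mul_inv_eq_iff_eq_mul, mul_inv_eq_iff_eq_mul]
    subst hqs
    ext x
    simp only [Equiv.Perm.mul_apply, Equiv.swap_apply_def]
    grind

/-! ### Supports, displaced half-trees and infinite products -/

namespace ColoredTree

variable {V Ω : Type*} (T : ColoredTree V Ω)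

theorem commute_of_fix {a b : T.Aut} {S : Set V} (ha : ∀ x ∉ S, a x = x) (hb : ∀ x ∈ S, b x = x) :
    Commute a b := by
  refine RelIso.ext fun x => ?_
  rw [RelIso.mul_apply, RelIso.mul_apply]
  by_cases hx : x ∈ S
  · have : a x ∈ S := by
      by_contra h
      rw [a.injective (ha _ h)] at h
      exact h hx
    rw [hb x hx, hb _ this]
  · have : b x ∉ S := by
      intro h
      rw [b.injective (hb _ h)] at h
      exact hx h
    rw [ha x hx, ha _ this]

theorem exists_translation (v w : V) :
    ∃ t : T.Aut, t v = w ∧ ∀ x, T.localPerm t x = 1 :=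
  T.exists_aut v w (fun _ => 1) fun _ _ => rfl

/-- The delicate vertex is `u`, which has a neighbour inside the half-tree: the local permutation
there fixes every colour but `c`, hence `c` as well. -/
theorem localPerm_eq_one_of_notMem {h : T.Aut} {u : V} {c : Ω}
    (hh : ∀ x ∉ T.halfTree u c, h x = x) {y : V} (hy : y ∉ T.halfTree u c) :
    T.localPerm h y = 1 := by
  have h1 : h (T.step u c) = T.step u c := by
    have h2 : T.localPerm h u c = c := by
      by_contra hne
      refine hne ((T.localPerm h u).injective ?_)
      rw [localPerm_eq_iff, hh u (T.notMem_halfTree_self u c), hh]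
      exact fun h3 => hne (T.halfTree_unique (T.step_mem_halfTree _ _) h3)
    rw [map_step, h2, hh u (T.notMem_halfTree_self u c)]
  refine T.localPerm_eq_one (hh y hy) fun e => ?_
  by_cases h2 : T.step y e ∈ T.halfTree u c
  · rw [(T.eq_of_mem_of_step_notMem h2 (e := e) (by rwa [step_step])).1, h1]
  · exact hh _ h2

/-- A nontrivial automorphism moves some half-tree off itself. -/
theorem exists_halfTree_moved [Fintype Ω] (h3 : 3 ≤ Fintype.card Ω) {g : T.Aut} (hg : g ≠ 1) :
    ∃ x c, ∀ y ∈ T.halfTree x c, g y ∉ T.halfTree x c := by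
  classical
  obtain ⟨x, hx⟩ : ∃ x, g x ≠ x := by
    by_contra! h
    exact hg (RelIso.ext h)
  obtain ⟨a, ha⟩ := T.exists_mem_halfTree hx
  obtain ⟨b, hb⟩ := T.exists_mem_halfTree (Ne.symm hx)
  -- The direction `c` must not point from `x` to `g x`, and its image must not point from `g x`
  -- back to `x`; then the half-tree and its image are disjoint.
  have hcard : ({a, (T.localPerm g x)⁻¹ b} : Finset Ω).card < Fintype.card Ω :=
    Finset.card_le_two.trans_lt (by omega)
  obtain ⟨c, hc⟩ : ∃ c, c ∉ ({a, (T.localPerm g x)⁻¹ b} : Finset Ω) := by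
    by_contra! h
    rw [Finset.eq_univ_of_forall h, Finset.card_univ] at hcard
    exact hcard.false
  simp only [Finset.mem_insert, Finset.mem_singleton, not_or] at hc
  refine ⟨x, c, fun y hy => ?_⟩
  refine Set.disjoint_right.1 (T.disjoint_halfTree (Ne.symm hx)
    (fun h => hc.1 (T.halfTree_unique h ha)) (fun h => hc.2 ?_)) ((T.map_mem_halfTree g).2 hy)
  rw [← T.halfTree_unique h hb]
  simp

theorem exists_pair_ne [Fintype Ω] (h3 : 3 ≤ Fintype.card Ω) (c : Ω) :
    ∃ a b : Ω, a ≠ c ∧ b ≠ c ∧ a ≠ b := by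
  classical
  have : 1 < (Finset.univ.erase c).card := by
    rw [Finset.card_erase_of_mem (Finset.mem_univ c), Finset.card_univ]
    omega
  obtain ⟨a, ha, b, hb, hab⟩ := Finset.one_lt_card.1 this
  exact ⟨a, b, Finset.ne_of_mem_erase ha, Finset.ne_of_mem_erase hb, hab⟩

theorem exists_ne_ne [Fintype Ω] (h3 : 3 ≤ Fintype.card Ω) (c e : Ω) : ∃ b : Ω, b ≠ c ∧ b ≠ e := by
  obtain ⟨a, b, ha, hb, hab⟩ := exists_pair_ne h3 c
  by_cases h : a = e
  · exact ⟨b, hb, fun h' => hab (h.trans h'.symm)⟩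
  · exact ⟨a, ha, h⟩

theorem exists_translation_into [Fintype Ω] (h3 : 3 ≤ Fintype.card Ω) (y : V) (e : Ω) (x : V)
    (c : Ω) : ∃ k : T.Aut, (∀ v, T.localPerm k v = 1) ∧ k ∈ T.typePreserving ∧
      ∀ z ∈ T.halfTree y e, k z ∈ T.halfTree x c := by
  obtain ⟨b, hbc, hbe⟩ := exists_ne_ne h3 c e
  obtain ⟨b', hb'b, hb'e⟩ := exists_ne_ne h3 b e
  have key : ∀ y', Even (T.graph.dist y y') → y' ∈ T.halfTree x c → x ∉ T.halfTree y' e →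
      ∃ k : T.Aut, (∀ v, T.localPerm k v = 1) ∧ k ∈ T.typePreserving ∧
        ∀ z ∈ T.halfTree y e, k z ∈ T.halfTree x c := by
    intro y' h1 h2 h4
    obtain ⟨k, rfl, hk⟩ := T.exists_translation y y'
    refine ⟨k, hk, (T.mem_typePreserving_iff k y).2 h1, fun z hz => T.halfTree_mono h4 h2 ?_⟩
    have := (T.map_mem_halfTree k).2 hz
    rwa [hk] at this
  have m2 : T.step (T.step x c) b ∈ T.halfTree x c :=
    T.halfTree_subset hbc (T.step_mem_halfTree _ _)
  have n2 : x ∈ T.halfTree (T.step (T.step x c) b) b := by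
    rw [mem_halfTree_step]
    intro h
    exact T.notMem_halfTree_self _ _ (T.halfTree_subset hbc h)
  have m3 : T.step (T.step (T.step x c) b) b' ∈ T.halfTree (T.step x c) b :=
    T.halfTree_subset hb'b (T.step_mem_halfTree _ _)
  have n3 : x ∈ T.halfTree (T.step (T.step (T.step x c) b) b') b' := by
    rw [mem_halfTree_step]
    exact fun h => hb'b (T.halfTree_unique h n2)
  -- Two candidate base points, at depths two and three in the target half-tree, so that one of them
  -- has the parity of `y`.
  by_cases heven : Even (T.graph.dist y (T.step (T.step x c) b))
  · exact key _ heven m2 fun h => hbe (T.halfTree_unique n2 h)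
  · exact key _ ((T.even_dist_step _ _ _).2 heven) (T.halfTree_subset hbc m3)
      fun h => hb'e (T.halfTree_unique n3 h)

/-- If `h` has support in a half-tree, then it is a twisted commutator of an infinite product of
translates of `h` and a translation. -/
theorem exists_shift [Fintype Ω] (h3 : 3 ≤ Fintype.card Ω) {F : Subgroup (Equiv.Perm Ω)}
    {h : T.Aut} (hF : h ∈ T.burgerMozes F) {u : V} {c : Ω}
    (hh : ∀ x ∉ T.halfTree u c, h x = x) :
    ∃ t X : T.Aut, (∀ v, T.localPerm t v = 1) ∧ t ∈ T.typePreserving ∧ X ∈ T.burgerMozes F ∧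
      X ∈ T.typePreserving ∧ t * X * t⁻¹ * h = X := by
  classical
  obtain ⟨c₁, c₂, h1, h2, h12⟩ := exists_pair_ne h3 c
  obtain ⟨t, htu, ht⟩ := T.exists_translation u (T.step (T.step u c₁) c₂)
  have htstep : ∀ v e, t (T.step v e) = T.step (t v) e := fun v e => by rw [map_step, ht]; rfl
  have hti : ∀ (i : ℕ) v e, (t⁻¹ ^ i) (T.step v e) = T.step ((t⁻¹ ^ i) v) e := by
    intro i
    induction i with
    | zero => intro v e; rfl
    | succ n ih =>
      intro v e
      rw [pow_succ, RelIso.mul_apply, RelIso.mul_apply, map_step, localPerm_inv, ht, inv_one, ih]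
      rfl
  -- Ping-pong: positive powers of `t` send the half-tree in direction `c` into the one in direction
  -- `c₁`, so the translates by distinct powers are disjoint.
  have hpp : ∀ z, z ∉ T.halfTree u c₂ → t z ∈ T.halfTree u c₁ := by
    intro z hz
    rw [← mem_halfTree_step, ← T.map_mem_halfTree t, htstep, htu, ht, step_step] at hz
    exact T.halfTree_subset h12.symm hz
  have hpp' : ∀ (i : ℕ) z, z ∈ T.halfTree u c → (t ^ (i + 1)) z ∈ T.halfTree u c₁ := by
    intro i
    induction i with
    | zero =>
      intro z hz
      rw [zero_add, pow_one]
      exact hpp z fun h => h2 (T.halfTree_unique h hz)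
    | succ n ih =>
      intro z hz
      rw [pow_succ', RelIso.mul_apply]
      exact hpp _ fun h => h12 (T.halfTree_unique (ih z hz) h)
  have hno : ∀ x, x ∉ T.halfTree u c₁ → ∀ i : ℕ, (t⁻¹ ^ (i + 1)) x ∉ T.halfTree u c := by
    intro x hx i hi
    have := hpp' i _ hi
    rw [← RelIso.mul_apply, inv_pow, mul_inv_cancel] at this
    exact hx this
  have hno' : ∀ x ∈ T.halfTree u c, ∀ i : ℕ, (t⁻¹ ^ (i + 1)) x ∉ T.halfTree u c := fun x hx =>
    hno x fun h => h1 (T.halfTree_unique h hx)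
  have hone : ∀ y ∉ T.halfTree u c, T.localPerm h y = 1 := fun y hy =>
    T.localPerm_eq_one_of_notMem hh hy
  -- The field of local permutations of the product of all `t ^ i * h * t⁻¹ ^ i` with `i ≥ 0`.
  -- Conjugation by `t` drops the factor `i = 0`, which is `h`.
  let s : V → Equiv.Perm Ω := fun x =>
    if hx : ∃ i : ℕ, (t⁻¹ ^ i) x ∈ T.halfTree u c then T.localPerm h ((t⁻¹ ^ hx.choose) x) else 1
  have hs1 : ∀ x, (∀ i : ℕ, (t⁻¹ ^ i) x ∉ T.halfTree u c) → s x = 1 := by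
    intro x hx
    simp only [s]
    rw [dif_neg]
    exact fun ⟨i, hi⟩ => hx i hi
  have hs2 : ∀ x (i : ℕ), (t⁻¹ ^ i) x ∈ T.halfTree u c → s x = T.localPerm h ((t⁻¹ ^ i) x) := by
    intro x i hi
    have hx : ∃ i : ℕ, (t⁻¹ ^ i) x ∈ T.halfTree u c := ⟨i, hi⟩
    have hlt : ∀ i j : ℕ, (t⁻¹ ^ i) x ∈ T.halfTree u c → (t⁻¹ ^ j) x ∈ T.halfTree u c → ¬ i < j := by
      intro i j hi hj hij
      obtain ⟨k, rfl⟩ := Nat.exists_eq_add_of_lt hij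
      refine hno' _ hi k ?_
      rwa [← RelIso.mul_apply, ← pow_add, add_comm, ← add_assoc]
    have hch : hx.choose = i := by
      have := hlt _ _ hi hx.choose_spec
      have := hlt _ _ hx.choose_spec hi
      omega
    simp only [s]
    rw [dif_pos hx, hch]
  -- Along an edge either one power of `t` serves both ends, or the edge leaves the support and its
  -- colour is fixed.
  have hcase : ∀ v e, s v e = e ∨
      ∃ i : ℕ, s v = T.localPerm h ((t⁻¹ ^ i) v) ∧
        s (T.step v e) = T.localPerm h ((t⁻¹ ^ i) (T.step v e)) := by
    intro v e
    by_cases hv : ∃ i : ℕ, (t⁻¹ ^ i) v ∈ T.halfTree u c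
    · obtain ⟨i, hi⟩ := hv
      by_cases hw : (t⁻¹ ^ i) (T.step v e) ∈ T.halfTree u c
      · exact Or.inr ⟨i, hs2 v i hi, hs2 _ i hw⟩
      · left
        rw [hs2 v i hi, ← localPerm_step, ← hti, hone _ hw]
        rfl
    · left
      rw [hs1 v (not_exists.1 hv)]
      rfl
  have hs : ∀ v e, s (T.step v e) e = s v e := by
    intro v e
    rcases hcase v e with hl | ⟨i, hi, hi'⟩
    · rcases hcase (T.step v e) e with hr | ⟨i, hi, hi'⟩
      · rw [hl, hr]
      · rw [step_step] at hi'
        rw [hi, hi', hti, localPerm_step]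
    · rw [hi, hi', hti, localPerm_step]
  obtain ⟨X, hXu, hX⟩ := T.exists_aut u u s hs
  refine ⟨t, X, ht, ?_, fun v => ?_, T.mem_typePreserving_of_fix hXu, ?_⟩
  · rw [T.mem_typePreserving_iff t u, htu, even_dist_step, even_dist_step]
    simp
  · rw [hX]
    by_cases hv : ∃ i : ℕ, (t⁻¹ ^ i) v ∈ T.halfTree u c
    · obtain ⟨i, hi⟩ := hv
      rw [hs2 v i hi]
      exact hF _
    · rw [hs1 v (not_exists.1 hv)]
      exact F.one_mem
  · have hsout : ∀ y, y ∉ T.halfTree u c → y ∉ T.halfTree u c₁ → s y = 1 := by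
      intro y hy hy1
      refine hs1 y fun i => ?_
      cases i with
      | zero => exact hy
      | succ n => exact hno y hy1 n
    refine T.aut_ext u ?_ fun x => ?_
    · have htinv : t⁻¹ u = T.step (T.step u c₂) c₁ := by
        have : t (T.step (T.step u c₂) c₁) = u := by rw [htstep, htstep, htu, step_step, step_step]
        rw [← this, RelIso.inv_apply_self, this]
      have hsu : s u = 1 := hsout u (T.notMem_halfTree_self _ _) (T.notMem_halfTree_self _ _)
      have hsu2 : s (T.step u c₂) = 1 := hsout _
        (fun h' => h2 (T.halfTree_unique (T.step_mem_halfTree _ _) h'))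
        (fun h' => h12 (T.halfTree_unique h' (T.step_mem_halfTree _ _)))
      have hXt : X (t⁻¹ u) = t⁻¹ u := by
        rw [htinv, map_step, map_step, hXu, hX, hX, hsu, Equiv.Perm.one_apply, hsu2]
        rfl
      rw [RelIso.mul_apply, RelIso.mul_apply, RelIso.mul_apply,
        hh u (T.notMem_halfTree_self _ _), hXt, RelIso.apply_inv_self, hXu]
    · simp only [localPerm_mul, localPerm_inv, ht, inv_one, mul_one, one_mul, hX]
      by_cases hx : x ∈ T.halfTree u c
      · have hhx : h x ∈ T.halfTree u c := by
          by_contra h'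
          rw [h.injective (hh _ h')] at h'
          exact h' hx
        rw [hs2 x 0 hx, hs1 (t⁻¹ (h x)), one_mul]
        · rfl
        · intro i
          have := hno' _ hhx i
          rwa [pow_succ, RelIso.mul_apply] at this
      · rw [hh x hx, hone x hx, mul_one]
        by_cases hv : ∃ i : ℕ, (t⁻¹ ^ i) x ∈ T.halfTree u c
        · obtain ⟨i, hi⟩ := hv
          cases i with
          | zero => exact absurd hi hx
          | succ n =>
            rw [hs2 x _ hi]
            rw [pow_succ, RelIso.mul_apply] at hi ⊢
            exact hs2 _ n hi
        · rw [hs1 x (not_exists.1 hv), hs1]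
          intro i hi
          refine hv ⟨i + 1, ?_⟩
          rwa [pow_succ, RelIso.mul_apply]

end ColoredTree

/-! ### Simplicity -/

namespace ColoredTree

variable {V Ω : Type*} (T : ColoredTree V Ω)

/-- The conditions on the local groups under which the simplicity of `G(F, F')⋆` is proved. -/
structure IsSimplePair [Fintype Ω] [DecidableEq Ω] (R F F' : Subgroup (Equiv.Perm Ω)) : Prop where
  regular : IsRegularPermGroup R
  le_left : R ≤ F
  le : F ≤ F'
  le_alternating : R ≤ alternatingGroup Ω
  alternating_le : alternatingGroup Ω ≤ F'
  decomp : ∀ (a : Ω), ∀ p ∈ F', ∃ f ∈ F, f a = a ∧ p * f⁻¹ ∈ alternatingGroup Ω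
  six_le : 6 ≤ Fintype.card Ω

/-- For a regular group the half-tree generators disappear: an element of `U(R)` fixing an edge is
trivial. -/
theorem almostPrescribedStar_self_le {R : Subgroup (Equiv.Perm Ω)} (hR : IsRegularPermGroup R)
    [Fintype Ω] (h3 : 3 ≤ Fintype.card Ω) {L : Subgroup T.Aut}
    (hL : ∀ w, ∀ p ∈ R, T.rotation hR w p ∈ L) : T.almostPrescribedStar R R ≤ L := by
  have : Nonempty Ω := Fintype.card_pos_iff.1 (by omega)
  refine T.almostPrescribedStar_le hR le_rfl le_rfl hL fun u c b hb hfix => ?_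
  obtain ⟨e, -, he, -⟩ := exists_pair_ne h3 c
  have hbu : b u = u := hfix u (T.notMem_halfTree_self u c)
  have : b = 1 := by
    refine T.aut_ext_of_agree u hbu ?_ fun v a hva => ?_
    · rw [localPerm_one]
      refine hR.free _ (hb u) e ?_
      rw [localPerm_eq_iff, hbu]
      exact hfix _ fun h => he (T.halfTree_unique (T.step_mem_halfTree u e) h)
    · rw [localPerm_one] at hva ⊢
      exact hR.free _ (hb v) a hva
  rw [this]
  exact L.one_mem

/-- Double commutator: `A = n * r⁻¹ * n⁻¹` is the identity on `S`, so it commutes with `r` and `s`.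
Since `A * r` is the commutator of `n` and `r⁻¹`, it lies in `N`, and its commutator with `s` equals
that of `r` and `s`. -/
theorem mul_mul_inv_mul_inv_mem {G N : Subgroup T.Aut}
    (hN : ∀ g ∈ G, ∀ n ∈ N, g * n * g⁻¹ ∈ N) {n : T.Aut} (hn : n ∈ N) {S : Set V}
    (hS : ∀ y ∈ S, n y ∉ S) {r s : T.Aut} (hr : r ∈ G) (hs : s ∈ G) (hrS : ∀ x ∉ S, r x = x)
    (hsS : ∀ x ∉ S, s x = x) : r * s * r⁻¹ * s⁻¹ ∈ N := by
  set A := n * r⁻¹ * n⁻¹ with hA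
  have hAS : ∀ x ∈ S, A x = x := by
    intro x hx
    have h1 : n⁻¹ x ∉ S := fun h => hS _ h (by rwa [RelIso.apply_inv_self])
    have h2 : r⁻¹ (n⁻¹ x) = n⁻¹ x := by
      conv_lhs => rw [← hrS _ h1]
      exact RelIso.inv_apply_self _ _
    rw [hA, RelIso.mul_apply, RelIso.mul_apply, h2, RelIso.apply_inv_self]
  have hcr : Commute A r := (T.commute_of_fix hrS hAS).symm
  have hcs : Commute A s := (T.commute_of_fix hsS hAS).symm
  have hAr : A * r ∈ N := by
    have := N.mul_mem hn (hN r⁻¹ (G.inv_mem hr) _ (N.inv_mem hn))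
    rwa [hA, show n * r⁻¹ * n⁻¹ * r = n * (r⁻¹ * n⁻¹ * r⁻¹⁻¹) by group]
  have h := N.mul_mem hAr (hN s hs _ (N.inv_mem hAr))
  have hc : Commute A (r * s * r⁻¹) := (hcr.mul_right hcs).mul_right hcr.inv_right
  have heq : A * r * (s * (A * r)⁻¹ * s⁻¹) = r * s * r⁻¹ * s⁻¹ := by
    calc A * r * (s * (A * r)⁻¹ * s⁻¹) = A * (r * s * r⁻¹) * A⁻¹ * s⁻¹ := by group
      _ = r * s * r⁻¹ * s⁻¹ := by rw [hc.eq, mul_inv_cancel_right]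
  rwa [heq] at h

variable [Fintype Ω] [DecidableEq Ω] {R F F' : Subgroup (Equiv.Perm Ω)}

theorem almostPrescribedStar_le_of_normal (hP : IsSimplePair R F F') {N : Subgroup T.Aut}
    (hN : ∀ g ∈ T.almostPrescribedStar F F', ∀ n ∈ N, g * n * g⁻¹ ∈ N)
    (hne : ∃ n ∈ N, n ≠ 1) : T.almostPrescribedStar F F' ≤ N := by
  obtain ⟨n, hn, hn1⟩ := hne
  have h6 := hP.six_le
  have h3 : 3 ≤ Fintype.card Ω := by omega
  have : Nonempty Ω := Fintype.card_pos_iff.1 (by omega)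
  have hR := hP.regular
  have hUG : ∀ g ∈ T.burgerMozes F, g ∈ T.typePreserving → g ∈ T.almostPrescribedStar F F' :=
    fun g hg hgt => ⟨T.burgerMozes_le hP.le hg, hgt⟩
  have htG : ∀ t : T.Aut, (∀ v, T.localPerm t v = 1) → t ∈ T.typePreserving →
      t ∈ T.almostPrescribedStar R R := fun t ht htt =>
    ⟨T.burgerMozes_le le_rfl fun v => by rw [ht]; exact R.one_mem, htt⟩
  have htF : ∀ t : T.Aut, (∀ v, T.localPerm t v = 1) → t ∈ T.typePreserving →
      t ∈ T.almostPrescribedStar F F' := fun t ht htt =>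
    hUG t (fun v => by rw [ht]; exact F.one_mem) htt
  obtain ⟨x₀, c₀, hmove⟩ := T.exists_halfTree_moved h3 hn1
  have hcomm : ∀ u c, ∀ r ∈ T.almostPrescribedStar F F', ∀ s ∈ T.almostPrescribedStar F F',
      (∀ x ∉ T.halfTree u c, r x = x) → (∀ x ∉ T.halfTree u c, s x = x) →
      r * s * r⁻¹ * s⁻¹ ∈ N := by
    intro u c r hr s hs hrS hsS
    obtain ⟨k, hk, hkt, hkmem⟩ := T.exists_translation_into h3 u c x₀ c₀
    have hk' : k⁻¹ * n * k⁻¹⁻¹ ∈ N := hN _ (inv_mem (htF k hk hkt)) n hn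
    refine T.mul_mul_inv_mul_inv_mem hN hk' (fun y hy h => ?_) hr hs hrS hsS
    have := hkmem _ h
    rw [RelIso.mul_apply, RelIso.mul_apply, inv_inv, RelIso.apply_inv_self] at this
    exact hmove _ (hkmem y hy) this
  have hthree : ∀ w, ∀ q : Equiv.Perm Ω, q.IsThreeCycle → T.rotation hR w q ∈ N := by
    intro w q hq
    obtain ⟨a, s, hs, hsa, hqa, hsq⟩ := hq.exists_commutator_eq h6
    have := hcomm (T.step w a) a (T.rotation hR w s)
      (T.rotation_mem_star hR hP.le_left hP.le w (hP.alternating_le hs)) (T.rotation hR w q)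
      (T.rotation_mem_star hR hP.le_left hP.le w (hP.alternating_le hq.mem_alternatingGroup))
      (fun x hx => T.rotation_apply_of_notMem hR hsa hx)
      (fun x hx => T.rotation_apply_of_notMem hR hqa hx)
    rw [← hsq]
    simpa only [← T.rotationHom_apply hR, ← map_inv, ← map_mul] using this
  have halt : ∀ w, ∀ p ∈ alternatingGroup Ω, T.rotation hR w p ∈ N := by
    intro w p hp
    have : alternatingGroup Ω ≤ N.comap (T.rotationHom hR w) := by
      rw [← Equiv.Perm.closure_three_cycles_eq_alternating, Subgroup.closure_le]
      exact fun q hq => hthree w q hq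
    exact this hp
  have hRN : T.almostPrescribedStar R R ≤ N :=
    T.almostPrescribedStar_self_le hR h3 fun w p hp => halt w p (hP.le_alternating hp)
  have hB : ∀ u c, ∀ b ∈ T.burgerMozes F, (∀ x ∉ T.halfTree u c, b x = x) → b ∈ N := by
    intro u c b hb hfix
    obtain ⟨t, X, ht, htt, hX, hXt, h⟩ := T.exists_shift h3 hb hfix
    have htN := hRN (htG t ht htt)
    have h4 := N.mul_mem htN (hN X⁻¹ (inv_mem (hUG X hX hXt)) _ (N.inv_mem htN))
    have : b = t * (X⁻¹ * t⁻¹ * X⁻¹⁻¹) := by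
      rw [← mul_right_inj (t * X * t⁻¹), h]
      group
    rwa [this]
  refine T.almostPrescribedStar_le hR hP.le_left hP.le (fun w p hp => ?_) hB
  obtain ⟨a⟩ := ‹Nonempty Ω›
  -- The factor `f` fixes `a`, so its rotation is supported in a half-tree and lies in `U(F)`; the
  -- other factor is even.
  obtain ⟨f, hf, hfa, hpf⟩ := hP.decomp a p hp
  have h1 : T.rotation hR w f ∈ N :=
    hB (T.step w a) a _ (T.rotation_mem_burgerMozes hR hP.le_left w hf)
      fun x hx => T.rotation_apply_of_notMem hR hfa hx
  have h2 := N.mul_mem (halt w _ hpf) h1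
  rwa [← rotation_mul, inv_mul_cancel_right] at h2

theorem isSimpleGroup_almostPrescribedStar (hP : IsSimplePair R F F') :
    IsSimpleGroup (T.almostPrescribedStar F F') := by
  have h6 := hP.six_le
  obtain ⟨v₀⟩ := T.isTree.connected.nonempty
  have hnt : ∃ p ∈ alternatingGroup Ω, p ≠ 1 := by
    obtain ⟨a, b, c, hab, hac, hbc⟩ := Fintype.two_lt_card_iff.1 (by omega : 2 < Fintype.card Ω)
    have := Equiv.Perm.isThreeCycle_swap_mul_swap_same hab hac hbc
    exact ⟨_, this.mem_alternatingGroup, this.ne_one⟩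
  obtain ⟨p, hp, hp1⟩ := hnt
  have hrot := T.rotation_mem_star hP.regular hP.le_left hP.le v₀ (hP.alternating_le hp)
  have : Nontrivial (T.almostPrescribedStar F F') := by
    refine ⟨⟨_, hrot⟩, 1, fun h => hp1 ?_⟩
    rw [← T.localPerm_rotation_self hP.regular v₀ p,
      show T.rotation hP.regular v₀ p = 1 from congrArg Subtype.val h]
    exact T.localPerm_one v₀
  refine ⟨fun N hN => ?_⟩
  by_cases hbot : N = ⊥
  · exact Or.inl hbot
  · right
    obtain ⟨⟨n, hn⟩, hn1⟩ := N.ne_bot_iff_exists_ne_one.1 hbot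
    have hle := T.almostPrescribedStar_le_of_normal hP
      (N := N.map (T.almostPrescribedStar F F').subtype) ?_ ?_
    · rw [eq_top_iff]
      intro g _
      obtain ⟨m, hm, hmg⟩ := hle g.2
      rwa [← Subtype.ext hmg]
    · rintro g hg _ ⟨m, hm, rfl⟩
      exact ⟨⟨g, hg⟩ * m * ⟨g, hg⟩⁻¹, hN.conj_mem m hm _, rfl⟩
    · exact ⟨_, ⟨n, hn, rfl⟩, fun h => hn1 (Subtype.ext (Subtype.ext h))⟩

end ColoredTree

namespace ColoredTree

variable {V Ω : Type*} (T : ColoredTree V Ω)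

/-! ### The topology of `G(F, F')⋆` -/

section Topology

open Topology

variable (F F' : Subgroup (Equiv.Perm Ω))

/-- The pointwise stabilizer of `S` in the intersection of `U(F)` and `G(F, F')⋆`. -/
def starFixator (S : Set V) : Subgroup (T.almostPrescribedStar F F') where
  carrier := {u | (u : T.Aut) ∈ T.burgerMozes F ∧ ∀ v ∈ S, (u : T.Aut) v = v}
  one_mem' := ⟨one_mem _, fun _ _ => rfl⟩
  mul_mem' := fun {g h} hg hh => ⟨mul_mem hg.1 hh.1, fun v hv =>
    (congrArg (g : T.Aut) (hh.2 v hv)).trans (hg.2 v hv)⟩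
  inv_mem' := fun {g} hg => ⟨inv_mem hg.1, fun v hv => by
    conv_lhs => rw [← hg.2 v hv]
    exact RelIso.inv_apply_self _ _⟩

variable {F F'}

theorem isOpen_star_iff {O : Set (T.almostPrescribedStar F F')} :
    IsOpen O ↔ ∀ g ∈ O, ∃ S : Set V, S.Finite ∧ ∀ u ∈ T.starFixator F F' S, g * u ∈ O := by
  have hind : IsOpen O ↔ ∃ O', IsOpen O' ∧ Subgroup.inclusion (inf_le_left :
      T.almostPrescribedStar F F' ≤ T.almostPrescribed F F') ⁻¹' O' = O := Iff.rfl
  rw [hind]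
  constructor
  · rintro ⟨O', hO', rfl⟩ g hg
    obtain ⟨S, hS, h⟩ := hO' _ hg
    exact ⟨S, hS, fun u hu => h (Subgroup.inclusion inf_le_left u) hu.1 hu.2⟩
  · intro hO
    refine ⟨Subgroup.inclusion inf_le_left '' O, ?_,
      Set.preimage_image_eq _ (Subgroup.inclusion_injective _)⟩
    rintro _ ⟨(g : T.almostPrescribedStar F F'), hg, rfl⟩
    obtain ⟨S, hS, h⟩ := hO g hg
    obtain ⟨v₀⟩ := T.isTree.connected.nonempty
    -- Fixing one vertex already forces type preservation, so `G(F, F')⋆` is open in `G(F, F')`.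
    refine ⟨insert v₀ S, hS.insert v₀, fun u hu hfix => ?_⟩
    have hut : (u : T.Aut) ∈ T.typePreserving :=
      T.mem_typePreserving_of_fix (hfix v₀ (Set.mem_insert _ _))
    let u' : T.almostPrescribedStar F F' := ⟨(u : T.Aut), u.2, hut⟩
    have hu' : u' ∈ T.starFixator F F' S :=
      ⟨hu, fun v hv => hfix v (Set.mem_insert_of_mem _ hv)⟩
    exact ⟨g * u', h u' hu', Subtype.ext rfl⟩

theorem mem_nhds_star_iff {A : Set (T.almostPrescribedStar F F')}
    {g : T.almostPrescribedStar F F'} :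
    A ∈ 𝓝 g ↔ ∃ S : Set V, S.Finite ∧ ∀ u ∈ T.starFixator F F' S, g * u ∈ A := by
  rw [mem_nhds_iff]
  constructor
  · rintro ⟨O, hOA, hO, hg⟩
    obtain ⟨S, hS, h⟩ := T.isOpen_star_iff.1 hO g hg
    exact ⟨S, hS, fun u hu => hOA (h u hu)⟩
  · rintro ⟨S, hS, h⟩
    refine ⟨{x | g⁻¹ * x ∈ T.starFixator F F' S}, fun x hx => ?_, ?_, ?_⟩
    · have := h _ hx
      rwa [mul_inv_cancel_left] at this
    · refine T.isOpen_star_iff.2 fun x hx => ⟨S, hS, fun u hu => ?_⟩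
      change g⁻¹ * (x * u) ∈ T.starFixator F F' S
      rw [← mul_assoc]
      exact mul_mem hx hu
    · change g⁻¹ * g ∈ T.starFixator F F' S
      rw [inv_mul_cancel]
      exact one_mem _

theorem hasBasis_nhds_one_star :
    (𝓝 (1 : T.almostPrescribedStar F F')).HasBasis Set.Finite
      fun S => (T.starFixator F F' S : Set (T.almostPrescribedStar F F')) :=
  ⟨fun A => by simp only [mem_nhds_star_iff, one_mul]; rfl⟩

theorem isOpen_starFixator {S : Set V} (hS : S.Finite) :
    IsOpen (T.starFixator F F' S : Set (T.almostPrescribedStar F F')) :=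
  T.isOpen_star_iff.2 fun _ hg => ⟨S, hS, fun _ hu => mul_mem hg hu⟩

theorem starFixator_mono {S S' : Set V} (h : S ⊆ S') :
    T.starFixator F F' S' ≤ T.starFixator F F' S := fun _ hu => ⟨hu.1, fun v hv => hu.2 v (h hv)⟩

/-- If `u` fixes the singularities of `g` and their neighbours, its local permutations there are
trivial, so conjugation by `g` creates no singularity. This makes conjugation continuous at `1`. -/
theorem exists_conj_mem_starFixator [Finite Ω] (g : T.almostPrescribedStar F F') {S : Set V}
    (hS : S.Finite) : ∃ S' : Set V, S'.Finite ∧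
      ∀ u ∈ T.starFixator F F' S', g * u * g⁻¹ ∈ T.starFixator F F' S := by
  set B := {v | T.localPerm (g : T.Aut) v ∉ F} with hB
  have hBfin : B.Finite := g.2.1.2
  refine ⟨((g : T.Aut) ⁻¹' S) ∪ B ∪ ⋃ c, (fun v => T.step v c) '' B,
    ((hS.preimage (g : T.Aut).injective.injOn).union hBfin).union
      (Set.finite_iUnion fun c => hBfin.image _), fun u hu => ⟨fun v => ?_, fun v hv => ?_⟩⟩
  · obtain ⟨x, rfl⟩ := (g : T.Aut).surjective v
    have h1 : T.localPerm ((g : T.Aut) * u * (g : T.Aut)⁻¹) ((g : T.Aut) x) =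
        T.localPerm (g : T.Aut) ((u : T.Aut) x) * T.localPerm (u : T.Aut) x *
          (T.localPerm (g : T.Aut) x)⁻¹ := by
      rw [localPerm_mul, localPerm_mul, localPerm_inv, RelIso.inv_apply_self]
    change T.localPerm ((g : T.Aut) * u * (g : T.Aut)⁻¹) ((g : T.Aut) x) ∈ F
    rw [h1]
    by_cases hx : x ∈ B
    · have h2 : (u : T.Aut) x = x := hu.2 x (Or.inl (Or.inr hx))
      rw [h2, T.localPerm_eq_one h2 fun c => hu.2 _ (Or.inr (Set.mem_iUnion.2 ⟨c, x, hx, rfl⟩)),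
        mul_one, mul_inv_cancel]
      exact F.one_mem
    · have h2 : (u : T.Aut) x ∉ B := fun h => hx (by
        rwa [(u : T.Aut).injective (hu.2 _ (Or.inl (Or.inr h)))] at h)
      exact F.mul_mem (F.mul_mem (not_not.1 h2) (hu.1 x)) (F.inv_mem (not_not.1 hx))
  · have h2 : (u : T.Aut) ((g : T.Aut)⁻¹ v) = (g : T.Aut)⁻¹ v :=
      hu.2 _ (Or.inl (Or.inl (by rwa [Set.mem_preimage, RelIso.apply_inv_self])))
    change (g : T.Aut) ((u : T.Aut) ((g : T.Aut)⁻¹ v)) = v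
    rw [h2, RelIso.apply_inv_self]

instance isTopologicalGroup_star [Finite Ω] :
    IsTopologicalGroup (T.almostPrescribedStar F F') := by
  have hb := T.hasBasis_nhds_one_star (F := F) (F' := F')
  refine IsTopologicalGroup.of_nhds_one ?_ ?_ ?_ ?_
  · refine (hb.prod_self.tendsto_iff hb).2 fun S hS => ⟨S, hS, fun x hx => ?_⟩
    exact mul_mem hx.1 hx.2
  · exact (hb.tendsto_iff hb).2 fun S hS => ⟨S, hS, fun x hx => inv_mem hx⟩
  · intro x₀
    ext A
    rw [Filter.mem_map, mem_nhds_star_iff, mem_nhds_star_iff]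
    simp only [one_mul, Set.mem_preimage]
  · intro x₀
    exact (hb.tendsto_iff hb).2 fun S hS => T.exists_conj_mem_starFixator x₀ hS

instance t2Space_star [Finite Ω] : T2Space (T.almostPrescribedStar F F') := by
  refine IsTopologicalGroup.t2Space_of_one_sep fun g hg => ?_
  obtain ⟨x, hx⟩ : ∃ x, (g : T.Aut) x ≠ x := by
    by_contra! h
    exact hg (Subtype.ext (RelIso.ext h))
  exact ⟨_, T.hasBasis_nhds_one_star.mem_of_mem (Set.finite_singleton x),
    fun h => hx (h.2 x rfl)⟩

theorem exists_finite_determining (v₀ x : V) : ∃ P : Set V, P.Finite ∧ ∀ g h : T.Aut,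
    g v₀ = h v₀ → (∀ y ∈ P, T.localPerm g y = T.localPerm h y) → g x = h x := by
  refine T.step_induction v₀ (p := fun x => ∃ P : Set V, P.Finite ∧ ∀ g h : T.Aut,
    g v₀ = h v₀ → (∀ y ∈ P, T.localPerm g y = T.localPerm h y) → g x = h x)
    ⟨∅, Set.finite_empty, fun g h h₀ _ => h₀⟩ ?_ x
  rintro v c ⟨P, hP, h⟩
  refine ⟨insert v P, hP.insert v, fun g h' h₀ hP' => ?_⟩
  rw [map_step, map_step, h g h' h₀ fun y hy => hP' y (Set.mem_insert_of_mem _ hy),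
    hP' v (Set.mem_insert _ _)]

/-- The fixator is the continuous image of the compatible fields with values in `F`, a closed subset
of a product of finite sets. Continuity holds because the image of a vertex depends on finitely many
local permutations. -/
theorem isCompact_starFixator_singleton [Finite Ω] (hFF' : F ≤ F') (v₀ : V) :
    IsCompact (T.starFixator F F' {v₀} : Set (T.almostPrescribedStar F F')) := by
  let : TopologicalSpace (Equiv.Perm Ω) := ⊥
  have : DiscreteTopology (Equiv.Perm Ω) := ⟨rfl⟩
  let C : Set (V → Equiv.Perm Ω) :=
    {s | (∀ v c, s (T.step v c) c = s v c) ∧ ∀ v, s v ∈ F}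
  have hev : ∀ x (A : Set (Equiv.Perm Ω)), IsClosed {s : V → Equiv.Perm Ω | s x ∈ A} := fun x A =>
    (isClosed_discrete A).preimage (continuous_apply x)
  have hC : IsClosed C := by
    have h1 : IsClosed {s : V → Equiv.Perm Ω | ∀ v c, s (T.step v c) c = s v c} := by
      simp only [Set.ofPred_forall]
      refine isClosed_iInter fun v => isClosed_iInter fun c => ?_
      have hcont : Continuous fun s : V → Equiv.Perm Ω => (s (T.step v c), s v) := by fun_prop
      exact (isClosed_discrete {q : Equiv.Perm Ω × Equiv.Perm Ω | q.1 c = q.2 c}).preimage hcont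
    have h2 : IsClosed {s : V → Equiv.Perm Ω | ∀ v, s v ∈ F} := by
      simp only [Set.ofPred_forall]
      exact isClosed_iInter fun v => hev v F
    exact h1.inter h2
  have : CompactSpace C := isCompact_iff_compactSpace.1 hC.isCompact
  choose f hf0 hfs using fun s : C => T.exists_aut v₀ v₀ s s.2.1
  have hfU : ∀ s, f s ∈ T.burgerMozes F := fun s v => by rw [hfs]; exact s.2.2 v
  let Φ : C → T.almostPrescribedStar F F' := fun s =>
    ⟨f s, T.burgerMozes_le hFF' (hfU s), T.mem_typePreserving_of_fix (hf0 s)⟩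
  have hΦ : Continuous Φ := by
    refine continuous_iff_continuousAt.2 fun s A hA => ?_
    obtain ⟨S, hS, h⟩ := T.mem_nhds_star_iff.1 hA
    choose P hP hPd using T.exists_finite_determining v₀
    have hmem : {s' : C | ∀ y ∈ ⋃ x ∈ S, P x, (s' : V → Equiv.Perm Ω) y = (s : V → Equiv.Perm Ω) y}
        ∈ 𝓝 s := by
      refine (Filter.eventually_all_finite (hS.biUnion fun x _ => hP x)).2 fun y _ => ?_
      have hc : Continuous fun s' : C => (s' : V → Equiv.Perm Ω) y :=
        (continuous_apply y).comp continuous_subtype_val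
      exact hc.continuousAt (IsOpen.mem_nhds (isOpen_discrete {(s : V → Equiv.Perm Ω) y}) rfl)
    refine Filter.mem_map.2 (Filter.mem_of_superset hmem fun s' hs' => ?_)
    have := h ((Φ s)⁻¹ * Φ s') ⟨mul_mem (inv_mem (hfU s)) (hfU s'), fun x hx => ?_⟩
    · rwa [mul_inv_cancel_left] at this
    · change (f s)⁻¹ (f s' x) = x
      rw [hPd x (f s') (f s) (by rw [hf0, hf0]) fun y hy => by
        rw [hfs, hfs]
        exact hs' y (Set.mem_biUnion hx hy), RelIso.inv_apply_self]
  convert isCompact_range hΦ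
  ext u
  constructor
  · intro hu
    refine ⟨⟨fun v => T.localPerm (u : T.Aut) v, fun v c => T.localPerm_step _ v c, hu.1⟩, ?_⟩
    refine Subtype.ext (T.aut_ext v₀ ?_ fun v => ?_)
    · exact (hf0 _).trans (hu.2 v₀ rfl).symm
    · exact hfs _ v
  · rintro ⟨s, rfl⟩
    refine ⟨hfU s, ?_⟩
    rintro v rfl
    exact hf0 s

theorem isCompact_starFixator [Finite Ω] (hFF' : F ≤ F') {S : Set V} (hS : S.Finite)
    (hne : S.Nonempty) :
    IsCompact (T.starFixator F F' S : Set (T.almostPrescribedStar F F')) := by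
  obtain ⟨v, hv⟩ := hne
  exact (T.isCompact_starFixator_singleton hFF' v).of_isClosed_subset
    (Subgroup.isClosed_of_isOpen _ (T.isOpen_starFixator hS))
    (T.starFixator_mono (Set.singleton_subset_iff.2 hv))

theorem locallyCompactSpace_star [Finite Ω] (hFF' : F ≤ F') :
    LocallyCompactSpace (T.almostPrescribedStar F F') := by
  obtain ⟨v₀⟩ := T.isTree.connected.nonempty
  exact (T.isCompact_starFixator_singleton hFF' v₀).locallyCompactSpace_of_mem_nhds_of_group
    (T.hasBasis_nhds_one_star.mem_of_mem (Set.finite_singleton v₀))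

/-- To absorb one more point, step away along a colour that points neither to the old set nor to the
new point; all of them are then behind. -/
theorem exists_subset_halfTree [Fintype Ω] (h3 : 3 ≤ Fintype.card Ω) {S : Set V} (hS : S.Finite) :
    ∃ w a, S ⊆ T.halfTree w a := by
  induction S, hS using Set.Finite.induction_on with
  | empty =>
    obtain ⟨v₀⟩ := T.isTree.connected.nonempty
    obtain ⟨a⟩ : Nonempty Ω := Fintype.card_pos_iff.1 (by omega)
    exact ⟨v₀, a, Set.empty_subset _⟩
  | @insert x S _ _ ih =>
    obtain ⟨w, a, h⟩ := ih
    obtain ⟨b, hba, hb⟩ : ∃ b, b ≠ a ∧ x ∉ T.halfTree w b := by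
      obtain ⟨b, b', hb, hb', hbb'⟩ := exists_pair_ne h3 a
      by_cases hx : x ∈ T.halfTree w b
      · exact ⟨b', hb', fun h' => hbb' (T.halfTree_unique hx h')⟩
      · exact ⟨b, hb, hx⟩
    refine ⟨T.step w b, b, Set.insert_subset (T.mem_halfTree_step.2 hb) fun y hy => ?_⟩
    exact T.mem_halfTree_step.2 fun h' => hba (T.halfTree_unique h' (h hy))

theorem not_discreteTopology_star [Fintype Ω] (h3 : 3 ≤ Fintype.card Ω)
    {R : Subgroup (Equiv.Perm Ω)} (hR : IsRegularPermGroup R) (hRF : R ≤ F) (hFF' : F ≤ F')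
    (hF : ∀ a, ∃ f ∈ F, f a = a ∧ f ≠ 1) :
    ¬ DiscreteTopology (T.almostPrescribedStar F F') := by
  intro _
  have h1 : ({1} : Set (T.almostPrescribedStar F F')) ∈ 𝓝 1 :=
    (isOpen_discrete _).mem_nhds rfl
  obtain ⟨S, hS, h⟩ := T.mem_nhds_star_iff.1 h1
  obtain ⟨w, a, hwa⟩ := T.exists_subset_halfTree h3 hS
  obtain ⟨f, hf, hfa, hf1⟩ := hF a
  have h2 := h ⟨_, T.rotation_mem_star hR hRF hFF' w (hFF' hf)⟩
    ⟨T.rotation_mem_burgerMozes hR hRF w hf, fun v hv => T.rotation_apply_of_mem hR hfa (hwa hv)⟩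
  rw [one_mul, Set.mem_singleton_iff] at h2
  apply hf1
  rw [← T.localPerm_rotation_self hR w f,
    show T.rotation hR w f = 1 from congrArg Subtype.val h2, localPerm_one]

theorem isCompactlyGeneratedGroup_star [Finite Ω] [Nonempty Ω] {R : Subgroup (Equiv.Perm Ω)}
    (hR : IsRegularPermGroup R) (hRF : R ≤ F) (hFF' : F ≤ F') :
    IsCompactlyGeneratedGroup (T.almostPrescribedStar F F') := by
  obtain ⟨v₀⟩ := T.isTree.connected.nonempty
  obtain ⟨c₀⟩ := ‹Nonempty Ω›
  set v₁ := T.step v₀ c₀ with hv₁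
  let ρ : V → F' → T.almostPrescribedStar F F' := fun w p =>
    ⟨T.rotation hR w p, T.rotation_mem_star hR hRF hFF' w p.2⟩
  let C : Set (T.almostPrescribedStar F F') :=
    (T.starFixator F F' {v₀} ∪ T.starFixator F F' {v₁}) ∪ (Set.range (ρ v₀) ∪ Set.range (ρ v₁))
  refine ⟨C, ((T.isCompact_starFixator_singleton hFF' v₀).union
    (T.isCompact_starFixator_singleton hFF' v₁)).union
    ((Set.finite_range _).isCompact.union (Set.finite_range _).isCompact), ?_⟩
  set L := (Subgroup.closure C).map (T.almostPrescribedStar F F').subtype with hL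
  have hCL : ∀ g ∈ C, (g : T.Aut) ∈ L := fun g hg => ⟨g, Subgroup.subset_closure hg, rfl⟩
  have hρ₀ : ∀ p ∈ F', T.rotation hR v₀ p ∈ L := fun p hp =>
    hCL (ρ v₀ ⟨p, hp⟩) (Or.inr (Or.inl ⟨_, rfl⟩))
  have hρ₁ : ∀ p ∈ F', T.rotation hR v₁ p ∈ L := fun p hp =>
    hCL (ρ v₁ ⟨p, hp⟩) (Or.inr (Or.inr ⟨_, rfl⟩))
  have hU : ∀ g ∈ T.burgerMozes F, g ∈ T.typePreserving → g ∈ L := by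
    intro g hg hgt
    obtain ⟨l, hl, hlR, hlt, hlg⟩ := T.exists_apply_eq hR (L := L) (c₀ := c₀)
      (fun r hr => hρ₀ r (hFF' (hRF hr))) (fun r hr => hρ₁ r (hFF' (hRF hr)))
      ((T.mem_typePreserving_iff g v₀).1 hgt)
    have hlF : l ∈ T.burgerMozes F := fun v => hRF (hlR v)
    have h1 : l⁻¹ * g ∈ T.burgerMozes F := mul_mem (inv_mem hlF) hg
    have h2 : l⁻¹ * g ∈ L := by
      refine hCL ⟨l⁻¹ * g, T.burgerMozes_le hFF' h1, T.typePreserving.mul_mem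
        (T.typePreserving.inv_mem hlt) hgt⟩
        (Or.inl (Or.inl ⟨h1, ?_⟩))
      rintro v rfl
      change l⁻¹ (g v) = v
      rw [← hlg, RelIso.inv_apply_self]
    have := L.mul_mem hl h2
    rwa [mul_inv_cancel_left] at this
  have hle : T.almostPrescribedStar F F' ≤ L := by
    refine T.almostPrescribedStar_le hR hRF hFF' (fun w p hp => ?_) fun u c b hb hfix =>
      hU b hb (T.mem_typePreserving_of_fix (hfix u (T.notMem_halfTree_self u c)))
    obtain ⟨l, hl, hlR, hlt, h⟩ := T.exists_apply_eq_or hR (L := L) (c₀ := c₀)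
      (fun r hr => hρ₀ r (hFF' (hRF hr))) (fun r hr => hρ₁ r (hFF' (hRF hr))) w
    -- Conjugation by `l` itself could change the local permutation `p`; a colour-preserving
    -- translation with the same effect on `v` does not.
    have key : ∀ v, l v = w → T.rotation hR v p ∈ L → T.rotation hR w p ∈ L := by
      intro v hv hvL
      obtain ⟨t, htv, ht⟩ := T.exists_translation v w
      have htL : t ∈ L := by
        refine hU t (fun x => by rw [ht]; exact F.one_mem)
          ((T.mem_typePreserving_iff t v).2 ?_)
        rw [htv, ← hv]
        exact (T.mem_typePreserving_iff l v).1 hlt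
      rw [← htv, ← T.rotation_conj hR ht]
      exact L.mul_mem (L.mul_mem htL hvL) (L.inv_mem htL)
    rcases h with h | h
    · exact key v₀ h (hρ₀ p hp)
    · exact key v₁ h (hρ₁ p hp)
  rw [eq_top_iff]
  intro g _
  obtain ⟨m, hm, hmg⟩ := hle g.2
  rwa [← Subtype.ext hmg]

end Topology

end ColoredTree

/-! ### Cocompact lattices from compact open complements -/

section Lattice

open Topology Pointwise

variable {G : Type*} [Group G]

/-- Applied to the modular character, this gives unimodularity. -/
theorem MonoidHom.eq_one_of_isSimpleGroup {M : Type*} [CommMonoid M] [IsSimpleGroup G]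
    (hG : ∃ a b : G, a * b ≠ b * a) (φ : G →* M) (g : G) : φ g = 1 := by
  rcases IsSimpleGroup.eq_bot_or_eq_top_of_normal φ.ker inferInstance with h | h
  · obtain ⟨a, b, hab⟩ := hG
    have h1 : a * b * (b * a)⁻¹ ∈ φ.ker := by
      rw [MonoidHom.mem_ker, map_mul, map_mul, mul_comm (φ a), ← map_mul, ← map_mul,
        mul_inv_cancel, map_one]
    rw [h, Subgroup.mem_bot, mul_inv_eq_one] at h1
    exact absurd h1 hab
  · have : g ∈ φ.ker := h ▸ Subgroup.mem_top g
    exact this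

variable [TopologicalSpace G] [IsTopologicalGroup G] [T2Space G]

/-- In a unimodular group, a countable discrete subgroup with a compact open complement is a
cocompact lattice. -/
theorem isCocompactLattice_of_complement [LocallyCompactSpace G]
    (huni : ∀ g : G, Measure.modularCharacterFun g = 1) (Γ K : Subgroup G)
    [DiscreteTopology Γ] [Countable Γ] (hKo : IsOpen (K : Set G)) (hKc : IsCompact (K : Set G))
    (hdisj : ∀ g ∈ K, g ∈ Γ → g = 1) (hmul : ∀ g : G, ∃ γ ∈ Γ, g * γ ∈ K) :
    IsCocompactLattice Γ := by
  have hcompact : CompactSpace (G ⧸ Γ) := by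
    refine ⟨?_⟩
    convert hKc.image (QuotientGroup.continuous_mk (N := Γ))
    refine (Set.eq_univ_of_forall fun x => ?_).symm
    obtain ⟨g, rfl⟩ := QuotientGroup.mk_surjective x
    obtain ⟨γ, hγ, h⟩ := hmul g
    exact ⟨g * γ, h, QuotientGroup.mk_mul_of_mem g hγ⟩
  refine ⟨⟨inferInstance, ?_⟩, hcompact⟩
  borelize G
  let : MeasurableSpace (G ⧸ Γ) := borel (G ⧸ Γ)
  have : BorelSpace (G ⧸ Γ) := ⟨rfl⟩
  have : SigmaCompactSpace G := by
    refine isSigmaCompact_univ_iff.1 ?_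
    have h1 := isSigmaCompact_iUnion_of_isCompact
      (fun γ : Γ => (fun x : G => x * (γ : G)) '' (K : Set G))
      fun γ => hKc.image (continuous_mul_const _)
    convert h1
    refine (Set.eq_univ_of_forall fun g => ?_).symm
    obtain ⟨γ, hγ, h⟩ := hmul g
    exact Set.mem_iUnion.2 ⟨⟨γ⁻¹, inv_mem hγ⟩, g * γ, h, mul_inv_cancel_right _ _⟩
  let ν : Measure G := Measure.haar
  have hright : ν.IsMulRightInvariant := ⟨fun g => by
    rw [Measure.map_right_mul_eq_modularCharacterFun_smul, huni, one_smul]⟩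
  have hfund : IsFundamentalDomain Γ.op (K : Set G) ν := by
    refine ⟨hKo.measurableSet.nullMeasurableSet, Filter.Eventually.of_forall fun g => ?_, ?_⟩
    · obtain ⟨γ, hγ, h⟩ := hmul g
      exact ⟨⟨MulOpposite.op γ, hγ⟩, h⟩
    · rintro ⟨γ, hγ⟩ ⟨γ', hγ'⟩ hne
      refine Disjoint.aedisjoint (Set.disjoint_left.2 ?_)
      rintro _ ⟨k, hk, rfl⟩ ⟨k', hk', hkk⟩
      have hkk' : k' * γ'.unop = k * γ.unop := hkk
      have h1 : k⁻¹ * k' = γ.unop * (γ'.unop)⁻¹ := by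
        rw [eq_mul_inv_iff_mul_eq, mul_assoc, hkk', inv_mul_cancel_left]
      have h2 := hdisj _ (K.mul_mem (K.inv_mem hk) hk') (h1 ▸ Γ.mul_mem hγ (Γ.inv_mem hγ'))
      rw [h1, mul_inv_eq_one] at h2
      exact hne (Subtype.ext (MulOpposite.unop_injective h2))
  have hπ : Measurable (QuotientGroup.mk : G → G ⧸ Γ) := QuotientGroup.continuous_mk.measurable
  have hKfin : IsFiniteMeasure (ν.restrict (K : Set G)) := ⟨by
    rw [Measure.restrict_apply_univ]
    exact hKc.measure_lt_top⟩
  let μ : Measure (G ⧸ Γ) := (ν.restrict (K : Set G)).map QuotientGroup.mk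
  have hμfin : IsFiniteMeasure μ := Measure.isFiniteMeasure_map _ _
  refine ⟨μ, fun h0 => ?_, hμfin, ?_, ⟨fun g A hA => ?_⟩⟩
  · have h1 : μ Set.univ = 0 := by rw [h0]; rfl
    rw [Measure.map_apply hπ MeasurableSet.univ, Set.preimage_univ,
      Measure.restrict_apply_univ] at h1
    exact hKo.measure_ne_zero ν ⟨1, K.one_mem⟩ h1
  · have : μ.InnerRegularCompactLTTop :=
      Measure.InnerRegularCompactLTTop.map_of_continuous QuotientGroup.continuous_mk
    infer_instance
  · have hA' : MeasurableSet ((QuotientGroup.mk : G → G ⧸ Γ) ⁻¹' A) := hπ hA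
    have hgA : MeasurableSet ((fun x : G ⧸ Γ => g • x) ⁻¹' A) :=
      (continuous_const_smul g).measurable hA
    -- Both `K` and `g • K` are fundamental domains for right translation by `Γ`, so they meet the
    -- `Γ`-invariant preimage of `A` in sets of equal measure.
    rw [Measure.map_apply hπ hgA, Measure.map_apply hπ hA, Measure.restrict_apply (hπ hgA),
      Measure.restrict_apply hA',
      hfund.measure_set_eq (hfund.smul_of_comm g) hA' fun γ => ?_]
    · refine Eq.trans ?_ (measure_preimage_mul ν g _)
      congr 1
      ext x
      simp only [Set.mem_inter_iff, Set.mem_preimage]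
      refine and_congr Iff.rfl ?_
      rw [← smul_eq_mul, Set.smul_mem_smul_set_iff]
    · ext x
      simp only [Set.mem_preimage]
      rw [show (((γ • x : G)) : G ⧸ Γ) = (x : G ⧸ Γ) from QuotientGroup.mk_mul_of_mem x γ.2]

end Lattice

/-! ### The even subgroup as a lattice -/

namespace ColoredTree

variable {V Ω : Type*} (T : ColoredTree V Ω)

theorem countable_vertices {V Ω : Type*} (T : ColoredTree V Ω) [Countable Ω] : Countable V := by
  obtain ⟨v₀⟩ := T.isTree.connected.nonempty
  have : Function.Surjective fun l : List Ω => l.foldl T.step v₀ := by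
    refine T.step_induction v₀ ⟨[], rfl⟩ ?_
    rintro _ c ⟨l, rfl⟩
    exact ⟨l ++ [c], by simp⟩
  exact this.countable

theorem almostPrescribedStar_mono {F₁ F₁' F₂ F₂' : Subgroup (Equiv.Perm Ω)} (h : F₁ ≤ F₂)
    (h' : F₁' ≤ F₂') : T.almostPrescribedStar F₁ F₁' ≤ T.almostPrescribedStar F₂ F₂' :=
  fun _ hg => ⟨⟨fun v => h' (hg.1.1 v), hg.1.2.subset fun _ hv hF => hv (h hF)⟩, hg.2⟩

/-- An element is encoded by its value and local permutation at `v₀` and the finite list of its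
singularities; elsewhere regularity of `R` leaves no choice. -/
theorem countable_almostPrescribedStar [Finite Ω] [Nonempty Ω] {R F' : Subgroup (Equiv.Perm Ω)}
    (hR : IsRegularPermGroup R) : Countable (T.almostPrescribedStar R F') := by
  classical
  have := T.countable_vertices
  obtain ⟨v₀⟩ := T.isTree.connected.nonempty
  let D : T.almostPrescribedStar R F' → V × Equiv.Perm Ω × Finset (V × Equiv.Perm Ω) := fun g =>
    ((g : T.Aut) v₀, T.localPerm g v₀, g.2.1.2.toFinset.image fun x => (x, T.localPerm g x))
  have hD : Function.Injective D := by
    intro g h hgh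
    have h0 : (g : T.Aut) v₀ = (h : T.Aut) v₀ := congrArg Prod.fst hgh
    have h1 : T.localPerm (g : T.Aut) v₀ = T.localPerm (h : T.Aut) v₀ :=
      congrArg (fun q => q.2.1) hgh
    have h2 := Finset.ext_iff.1 (congrArg (fun q => q.2.2) hgh)
    have key : ∀ v p, (T.localPerm (g : T.Aut) v ∉ R ∧ T.localPerm (g : T.Aut) v = p) ↔
        (T.localPerm (h : T.Aut) v ∉ R ∧ T.localPerm (h : T.Aut) v = p) := by
      intro v p
      have := h2 (v, p)
      simp only [D, Finset.mem_image, Set.Finite.mem_toFinset, Set.mem_ofPred_eq,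
        Prod.mk.injEq] at this
      constructor
      · rintro ⟨h3, h4⟩
        obtain ⟨a, h5, rfl, h6⟩ := this.1 ⟨v, h3, rfl, h4⟩
        exact ⟨h5, h6⟩
      · rintro ⟨h3, h4⟩
        obtain ⟨a, h5, rfl, h6⟩ := this.2 ⟨v, h3, rfl, h4⟩
        exact ⟨h5, h6⟩
    refine Subtype.ext (T.aut_ext_of_agree v₀ h0 h1 fun v c hc => ?_)
    by_cases hg : T.localPerm (g : T.Aut) v ∈ R
    · by_cases hh : T.localPerm (h : T.Aut) v ∈ R
      · exact hR.eq_of_apply_eq hg hh hc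
      · exact absurd hg ((key v _).2 ⟨hh, rfl⟩).1
    · exact ((key v _).1 ⟨hg, rfl⟩).2.symm
  exact hD.countable

/-- If the even part of `F` is regular and the point stabilizers in `F` contain permutations of
either sign, then `G(F ∩ Alt, Alt)⋆` is a cocompact lattice in `G(F, Sym)⋆`, provided that the
latter is simple and nonabelian. -/
theorem isCocompactLattice_subgroupOf [Fintype Ω] [DecidableEq Ω] [Nonempty Ω]
    {F : Subgroup (Equiv.Perm Ω)} (hR : IsRegularPermGroup (F ⊓ alternatingGroup Ω))
    (hF : ∀ a ε, ∃ f ∈ F, f a = a ∧ Equiv.Perm.sign f = ε)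
    (hsimple : IsSimpleGroup (T.almostPrescribedStar F ⊤))
    (hnc : ∃ a b : T.almostPrescribedStar F ⊤, a * b ≠ b * a) :
    IsCocompactLattice
      ((T.almostPrescribedStar (F ⊓ alternatingGroup Ω) (alternatingGroup Ω)).subgroupOf
        (T.almostPrescribedStar F ⊤)) := by
  have hle := T.almostPrescribedStar_mono (inf_le_left : F ⊓ alternatingGroup Ω ≤ F)
    (le_top : alternatingGroup Ω ≤ ⊤)
  have := T.locallyCompactSpace_star (le_top : F ≤ ⊤)
  obtain ⟨v₀⟩ := T.isTree.connected.nonempty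
  obtain ⟨c₀⟩ := ‹Nonempty Ω›
  have hS : ({v₀, T.step v₀ c₀} : Set V).Finite := Set.toFinite _
  set K := T.starFixator F ⊤ {v₀, T.step v₀ c₀} with hK
  set Γ := (T.almostPrescribedStar (F ⊓ alternatingGroup Ω) (alternatingGroup Ω)).subgroupOf
        (T.almostPrescribedStar F ⊤) with hΓ
  have hdisj : ∀ g ∈ K, g ∈ Γ → g = 1 := by
    intro g hg hgΓ
    have hgR : ∀ v, T.localPerm (g : T.Aut) v ∈ F ⊓ alternatingGroup Ω := fun v =>
      ⟨hg.1 v, (Subgroup.mem_subgroupOf.1 hgΓ).1.1 v⟩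
    have h0 : (g : T.Aut) v₀ = v₀ := hg.2 v₀ (Or.inl rfl)
    refine Subtype.ext (T.aut_ext_of_agree (h := 1) v₀ h0 ?_ fun v c hc => ?_)
    · rw [localPerm_one]
      refine hR.free _ (hgR v₀) c₀ ?_
      rw [localPerm_eq_iff, h0]
      exact hg.2 _ (Or.inr rfl)
    · rw [localPerm_one] at hc ⊢
      exact hR.free _ (hgR v) c hc
  have hKo : IsOpen (K : Set (T.almostPrescribedStar F ⊤)) := T.isOpen_starFixator hS
  have : DiscreteTopology Γ := by
    refine discreteTopology_of_isOpen_singleton_one ?_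
    convert hKo.preimage (continuous_subtype_val (p := (· ∈ Γ)))
    ext g
    constructor
    · rintro rfl
      exact K.one_mem
    · exact fun h => Subtype.ext (hdisj _ h g.2)
  have : Countable Γ := by
    have := T.countable_almostPrescribedStar (F' := alternatingGroup Ω) hR
    exact (Subgroup.subgroupOfEquivOfLe hle).toEquiv.countable_iff.2 this
  refine isCocompactLattice_of_complement
    (fun g => MonoidHom.eq_one_of_isSimpleGroup hnc Measure.modularCharacter g) Γ K hKo
    (T.isCompact_starFixator le_top hS ⟨v₀, Or.inl rfl⟩) hdisj fun g => ?_
  -- The elements of `F` with a given sign are transitive: an even element moves `a` to `b`, and a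
  -- stabilizer element of `a` sets the sign. The resulting `h` has the signs of `g⁻¹` everywhere,
  -- so `g⁻¹ * h⁻¹` is even at every vertex.
  have hA : ∀ (v : V) (a b : Ω), ∃ p ∈ {p : Equiv.Perm Ω | p ∈ F ∧
      Equiv.Perm.sign p = Equiv.Perm.sign (T.localPerm (g⁻¹ : T.almostPrescribedStar F ⊤) v)},
      p a = b := by
    intro v a b
    obtain ⟨r, hr, hrab⟩ := hR.trans a b
    obtain ⟨f, hf, hfa, hfs⟩ := hF a
      (Equiv.Perm.sign (T.localPerm (g⁻¹ : T.almostPrescribedStar F ⊤) v))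
    have hrs : Equiv.Perm.sign r = 1 := hr.2
    exact ⟨r * f, ⟨F.mul_mem hr.1 hf, by rw [map_mul, hrs, one_mul, hfs]⟩, by
      rw [Equiv.Perm.mul_apply, hfa, hrab]⟩
  obtain ⟨h, hh0, hhc, hhA⟩ := T.exists_aut_localPerm_mem v₀ v₀ _ hA c₀ c₀
  have hhU : h ∈ T.burgerMozes F := fun v => (hhA v).1
  let k : T.almostPrescribedStar F ⊤ :=
    ⟨h, T.burgerMozes_le le_top hhU, T.mem_typePreserving_of_fix hh0⟩
  have hkK : k ∈ K := by
    refine ⟨hhU, ?_⟩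
    rintro v (rfl | rfl)
    · exact hh0
    · change h (T.step v₀ c₀) = T.step v₀ c₀
      rw [map_step, hh0, hhc]
  refine ⟨g⁻¹ * k⁻¹, ?_, by rw [mul_inv_cancel_left]; exact K.inv_mem hkK⟩
  refine Subgroup.mem_subgroupOf.2 ?_
  set g' : T.Aut := ((g⁻¹ : T.almostPrescribedStar F ⊤) : T.Aut) with hg'
  have hg'm : g' ∈ T.almostPrescribedStar F ⊤ := (g⁻¹).2
  change g' * h⁻¹ ∈ _
  have hm : g' * h⁻¹ ∈ T.almostPrescribedStar F ⊤ := mul_mem hg'm (inv_mem k.2)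
  have halt : ∀ v, T.localPerm (g' * h⁻¹) v ∈ alternatingGroup Ω := by
    intro v
    rw [localPerm_mul, localPerm_inv, Equiv.Perm.mem_alternatingGroup, map_mul, map_inv,
      (hhA _).2, mul_inv_cancel]
  exact ⟨⟨halt, hm.1.2.subset fun v hv hvF => hv ⟨hvF, halt v⟩⟩, hm.2⟩

end ColoredTree

/-! ### Signs in the dihedral group -/

/-- Negation on `ZMod d` is an odd permutation if `d` is `0` or `3` modulo `4`. -/
theorem ZMod.sign_neg (d : ℕ) [NeZero d] (hd : d % 4 = 0 ∨ d % 4 = 3) :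
    Equiv.Perm.sign (Equiv.neg (ZMod d)) = -1 := by
  set σ := Equiv.neg (ZMod d) with hσ
  have h2 : σ ^ 2 = 1 := by
    ext x
    simp [hσ, sq]
  have hrep : σ.cycleType = Multiset.replicate (Multiset.card σ.cycleType) 2 :=
    Multiset.eq_replicate.2 ⟨rfl, (Equiv.Perm.pow_prime_eq_one_iff (hp := ⟨Nat.prime_two⟩)).1 h2⟩
  have hsum : σ.cycleType.sum = 2 * Multiset.card σ.cycleType := by
    conv_lhs => rw [hrep]
    simp [mul_comm]
  have hsupp : σ.support.card + (σ.supportᶜ).card = d := by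
    rw [Finset.card_add_card_compl, ZMod.card]
  rw [← Equiv.Perm.sum_cycleType] at hsupp
  have hfix : ∀ x : ZMod d, x ∈ σ.supportᶜ ↔ x = 0 ∨ 2 * x.val = d := by
    intro x
    simp only [Finset.mem_compl, Equiv.Perm.mem_support, not_not, hσ, Equiv.neg_apply]
    exact ZMod.neg_eq_self_iff x
  rw [Equiv.Perm.sign_of_cycleType, hsum]
  -- Negation has `(d - 2) / 2` transpositions if `d` is even (fixed points `0` and `d / 2`) and `(d
  -- - 1) / 2` if `d` is odd; the congruence makes this number odd.
  obtain ⟨m, hm⟩ : ∃ m, Multiset.card σ.cycleType = 2 * m + 1 := by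
    rcases hd with hd | hd
    · have hd0 := NeZero.pos d
      have : σ.supportᶜ = {0, ((d / 2 : ℕ) : ZMod d)} := by
        ext x
        rw [hfix, Finset.mem_insert, Finset.mem_singleton]
        refine or_congr_right ⟨fun h => ?_, fun h => ?_⟩
        · have hx : x.val = d / 2 := by omega
          rw [← hx, ZMod.natCast_zmod_val]
        · rw [h, ZMod.val_natCast, Nat.mod_eq_of_lt (by omega)]
          omega
      rw [this, Finset.card_pair] at hsupp
      · exact ⟨d / 4 - 1, by omega⟩
      · intro h
        have := congrArg ZMod.val h
        rw [ZMod.val_zero, ZMod.val_natCast, Nat.mod_eq_of_lt (by omega)] at this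
        omega
    · have : σ.supportᶜ = {0} := by
        ext x
        rw [hfix, Finset.mem_singleton]
        exact ⟨fun h => h.resolve_right (by omega), Or.inl⟩
      rw [this, Finset.card_singleton] at hsupp
      exact ⟨d / 4, by omega⟩
  rw [hm]
  simp [pow_add, pow_mul, mul_add]

namespace dihedralPerm

variable {d : ℕ}

/-- The rotation by `k`. -/
theorem addLeft_mem (k : ZMod d) : Equiv.addLeft k ∈ dihedralPerm d :=
  ⟨k, Or.inl fun _ => rfl⟩

theorem subLeft_mem (k : ZMod d) : Equiv.subLeft k ∈ dihedralPerm d :=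
  ⟨k, Or.inr fun _ => rfl⟩

variable [NeZero d] (hd : d % 4 = 0 ∨ d % 4 = 3)
include hd

theorem sign_subLeft (a : ZMod d) : Equiv.Perm.sign (Equiv.subLeft (2 * a)) = -1 := by
  have : Equiv.subLeft (2 * a) = Equiv.addLeft a * Equiv.neg (ZMod d) * (Equiv.addLeft a)⁻¹ := by
    ext x
    simp
    ring
  rw [this, map_mul, map_mul, map_inv, mul_inv_cancel_comm, ZMod.sign_neg d hd]

/-- Free: a nontrivial dihedral element fixing `a` is the reflection in `a`, which is odd.
Transitive: if the translation by `b - a` is odd, precompose it with that reflection. -/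
theorem isRegularPermGroup : IsRegularPermGroup (dihedralPerm d ⊓ alternatingGroup (ZMod d)) := by
  constructor
  · intro a b
    rcases Int.units_eq_one_or (Equiv.Perm.sign (Equiv.addLeft (b - a))) with h | h
    · exact ⟨_, ⟨addLeft_mem (b - a), h⟩, by simp⟩
    · refine ⟨Equiv.addLeft (b - a) * Equiv.subLeft (2 * a),
        ⟨mul_mem (addLeft_mem _) (subLeft_mem _), ?_⟩, ?_⟩
      · change Equiv.Perm.sign _ = 1
        rw [map_mul, h, sign_subLeft hd]
        rfl
      · simp
        ring
  · rintro r ⟨⟨k, hk | hk⟩, hr⟩ a ha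
    · ext x
      have : k = 0 := by rwa [hk, add_eq_right] at ha
      rw [hk, this, zero_add]
      rfl
    · have hk2 : k = 2 * a := by
        rw [hk, sub_eq_iff_eq_add] at ha
        rw [ha]
        ring
      have : r = Equiv.subLeft (2 * a) := by
        ext x
        rw [hk, hk2]
        rfl
      change Equiv.Perm.sign r = 1 at hr
      rw [this, sign_subLeft hd] at hr
      exact absurd hr (by decide)

theorem exists_mem_sign_eq (a : ZMod d) (ε : ℤˣ) :
    ∃ f ∈ dihedralPerm d, f a = a ∧ Equiv.Perm.sign f = ε := by
  rcases Int.units_eq_one_or ε with rfl | rfl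
  · exact ⟨1, one_mem _, rfl, map_one _⟩
  · exact ⟨_, subLeft_mem _, by simp; ring, sign_subLeft hd a⟩

theorem isSimplePair_top (h7 : 7 ≤ d) :
    ColoredTree.IsSimplePair (dihedralPerm d ⊓ alternatingGroup (ZMod d)) (dihedralPerm d) ⊤ where
  regular := isRegularPermGroup hd
  le_left := inf_le_left
  le := le_top
  le_alternating := inf_le_right
  alternating_le := le_top
  decomp a p _ := by
    obtain ⟨f, hf, hfa, hfs⟩ := exists_mem_sign_eq hd a (Equiv.Perm.sign p)
    exact ⟨f, hf, hfa, by rw [Equiv.Perm.mem_alternatingGroup, map_mul, map_inv, hfs,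
      mul_inv_cancel]⟩
  six_le := by
    rw [ZMod.card]
    omega

theorem isSimplePair_alternating (h7 : 7 ≤ d) :
    ColoredTree.IsSimplePair (dihedralPerm d ⊓ alternatingGroup (ZMod d))
      (dihedralPerm d ⊓ alternatingGroup (ZMod d)) (alternatingGroup (ZMod d)) where
  regular := isRegularPermGroup hd
  le_left := le_rfl
  le := inf_le_right
  le_alternating := inf_le_right
  alternating_le := le_rfl
  decomp a p hp := ⟨1, one_mem _, rfl, by simpa using hp⟩
  six_le := by
    rw [ZMod.card]
    omega

end dihedralPerm

/-! ### Existence of coloured regular trees -/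

section ReducedWords

variable (Ω : Type*)

/-- Words without two equal consecutive letters. -/
abbrev ReducedWord : Type _ := {l : List Ω // l.IsChain (· ≠ ·)}

namespace ReducedWord

/-- The graph on the reduced words in which the neighbours of a word arise from it by adding or
removing a first letter. -/
def graph : SimpleGraph (ReducedWord Ω) where
  Adj v w := ∃ c, (w : List Ω) = c :: v ∨ (v : List Ω) = c :: w
  symm := ⟨fun _ _ ⟨c, h⟩ => ⟨c, h.symm⟩⟩
  loopless := ⟨fun _ ⟨_, h⟩ => by rcases h with h | h <;> simpa using congrArg List.length h⟩

variable {Ω}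

theorem exists_edge_eq {e : Sym2 (ReducedWord Ω)} (he : e ∈ (graph Ω).edgeSet) :
    ∃ c, ∃ v w : ReducedWord Ω, e = s(v, w) ∧ (w : List Ω) = c :: v := by
  induction e with
  | _ v w =>
    obtain ⟨c, h | h⟩ := he
    · exact ⟨c, v, w, rfl, h⟩
    · exact ⟨c, w, v, Sym2.eq_swap, h⟩

/-- The letter by which the two endpoints of an edge differ. -/
noncomputable def color (e : (graph Ω).edgeSet) : Ω := (exists_edge_eq e.2).choose

theorem color_eq {v w : ReducedWord Ω} {c : Ω} (h : (graph Ω).Adj v w)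
    (hc : (w : List Ω) = c :: v ∨ (v : List Ω) = c :: w) : color ⟨s(v, w), h⟩ = c := by
  obtain ⟨v', w', h1, h2⟩ := (exists_edge_eq (e := s(v, w)) h).choose_spec
  change (exists_edge_eq (e := s(v, w)) h).choose = c
  generalize (exists_edge_eq (e := s(v, w)) h).choose = c' at *
  rcases Sym2.eq_iff.1 h1 with ⟨rfl, rfl⟩ | ⟨rfl, rfl⟩ <;> rcases hc with hc | hc <;>
    have h3 := congrArg List.length hc <;> have h4 := congrArg List.length h2 <;>
    simp only [List.length_cons] at h3 h4
  · rw [hc] at h2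
    exact (List.cons.inj h2).1.symm
  · omega
  · omega
  · rw [hc] at h2
    exact (List.cons.inj h2).1.symm

theorem adj_iff_color {v w : ReducedWord Ω} (h : (graph Ω).Adj v w) :
    (w : List Ω) = color ⟨s(v, w), h⟩ :: v ∨ (v : List Ω) = color ⟨s(v, w), h⟩ :: w := by
  obtain ⟨c, hc⟩ := h
  rwa [color_eq ⟨c, hc⟩ hc]

theorem reachable_nil (v : ReducedWord Ω) : (graph Ω).Reachable ⟨[], List.isChain_nil⟩ v := by
  obtain ⟨l, hl⟩ := v
  induction l with
  | nil => exact SimpleGraph.Reachable.refl _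
  | cons c l ih =>
    have hl' : l.IsChain (· ≠ ·) := hl.tail
    refine (ih hl').trans (SimpleGraph.Adj.reachable ?_)
    exact ⟨c, Or.inl rfl⟩

theorem isTree_graph : (graph Ω).IsTree := by
  have : Nonempty (ReducedWord Ω) := ⟨⟨[], List.isChain_nil⟩⟩
  refine ⟨⟨fun v w => (reachable_nil v).symm.trans (reachable_nil w)⟩, ?_⟩
  refine SimpleGraph.isAcyclic_iff_forall_isBridge.2 fun e he => ?_
  obtain ⟨c, v, w, rfl, hw⟩ := exists_edge_eq he
  rw [SimpleGraph.isBridge_iff]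
  rintro ⟨p⟩
  -- The words ending in `w` can be left only through the deleted edge, so every edge is a bridge.
  have key : ∀ {x y : ReducedWord Ω}, ((graph Ω).deleteEdges {s(v, w)}).Walk x y →
      (w : List Ω) <:+ y → (w : List Ω) <:+ x := by
    intro x y p
    induction p with
    | nil => exact id
    | @cons x z y hadj _ ih =>
      intro hy
      have hz := ih hy
      rw [SimpleGraph.deleteEdges_adj] at hadj
      obtain ⟨⟨a, h | h⟩, hne⟩ := hadj
      · rw [h, List.suffix_cons_iff] at hz
        rcases hz with hz | hz
        · refine absurd ?_ hne
          have h1 : w = z := Subtype.ext (hz.trans h.symm)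
          have h2 : v = x := by
            rw [hz] at hw
            exact Subtype.ext (List.cons.inj hw).2.symm
          rw [h1, h2]
          rfl
        · exact hz
      · rw [h]
        exact hz.trans (List.suffix_cons _ _)
  have h1 := (key p List.suffix_rfl).length_le
  rw [hw, List.length_cons] at h1
  omega

theorem bijective_color (v : ReducedWord Ω) : Function.Bijective
    (fun w : (graph Ω).neighborSet v => color ⟨s(v, (w : ReducedWord Ω)), w.2⟩) := by
  constructor
  · rintro ⟨w, hw⟩ ⟨w', hw'⟩ h
    change color ⟨s(v, w), hw⟩ = color ⟨s(v, w'), hw'⟩ at h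
    refine Subtype.ext (Subtype.ext ?_)
    change (w : List Ω) = w'
    have h1 := adj_iff_color hw
    have h2 := adj_iff_color hw'
    rw [← h] at h2
    generalize color ⟨s(v, w), hw⟩ = c at *
    rcases h1 with h1 | h1 <;> rcases h2 with h2 | h2
    · rw [h1, h2]
    · have := w.2
      rw [h1, h2] at this
      exact absurd rfl (List.isChain_cons_cons.1 this).1
    · have := w'.2
      rw [h2, h1] at this
      exact absurd rfl (List.isChain_cons_cons.1 this).1
    · rw [h1] at h2
      exact (List.cons.inj h2).2
  · intro c
    by_cases h : ∃ l, (v : List Ω) = c :: l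
    · obtain ⟨l, hl⟩ := h
      have hl' : l.IsChain (· ≠ ·) := by
        have := v.2
        rw [hl] at this
        exact this.tail
      have hadj : (graph Ω).Adj v ⟨l, hl'⟩ := ⟨c, Or.inr hl⟩
      exact ⟨⟨_, hadj⟩, color_eq hadj (Or.inr hl)⟩
    · have hl' : (c :: (v : List Ω)).IsChain (· ≠ ·) := by
        obtain ⟨l, hl⟩ := v
        cases l with
        | nil => exact List.isChain_singleton _
        | cons a l =>
          refine List.isChain_cons_cons.2 ⟨?_, hl⟩
          rintro rfl
          exact h ⟨l, rfl⟩
      have hadj : (graph Ω).Adj v ⟨_, hl'⟩ := ⟨c, Or.inl rfl⟩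
      exact ⟨⟨_, hadj⟩, color_eq hadj (Or.inl rfl)⟩

/-- The coloured regular tree whose vertices are the reduced words. -/
noncomputable def coloredTree : ColoredTree (ReducedWord Ω) Ω where
  graph := graph Ω
  isTree := isTree_graph
  color := color
  legal := bijective_color

end ReducedWord

end ReducedWords

/-! ### Conclusion -/

theorem ColoredTree.isNondiscreteSimpleLCGroup_and_isCocompactLattice {d : ℕ} [NeZero d]
    (h7 : 7 ≤ d) (hd : d % 4 = 0 ∨ d % 4 = 3) {V : Type*} (T : ColoredTree V (ZMod d)) :
    IsNondiscreteSimpleLCGroup (T.almostPrescribedStar (dihedralPerm d) ⊤) ∧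
      IsCocompactLattice
        ((T.almostPrescribedStar (dihedralPerm d ⊓ alternatingGroup (ZMod d))
            (alternatingGroup (ZMod d))).subgroupOf
          (T.almostPrescribedStar (dihedralPerm d) ⊤)) := by
  have hP := dihedralPerm.isSimplePair_top hd h7
  have hR := hP.regular
  have hsimple := T.isSimpleGroup_almostPrescribedStar hP
  refine ⟨⟨inferInstance, inferInstance, T.locallyCompactSpace_star le_top,
    T.not_discreteTopology_star (by rw [ZMod.card]; omega) hR hP.le_left le_top fun a => ?_,
    T.isCompactlyGeneratedGroup_star hR hP.le_left le_top, hsimple⟩,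
    T.isCocompactLattice_subgroupOf hR (dihedralPerm.exists_mem_sign_eq hd) hsimple ?_⟩
  · obtain ⟨f, hf, hfa, hfs⟩ := dihedralPerm.exists_mem_sign_eq hd a (-1)
    refine ⟨f, hf, hfa, ?_⟩
    rintro rfl
    rw [map_one] at hfs
    exact absurd hfs (by decide)
  · obtain ⟨v₀⟩ := T.isTree.connected.nonempty
    obtain ⟨a, b, c, hab, hac, hbc⟩ :=
      Fintype.two_lt_card_iff.1 (by rw [ZMod.card]; omega : 2 < Fintype.card (ZMod d))
    -- Rotations about one vertex embed the symmetric group, so two overlapping transpositions show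
    -- that the group is nonabelian.
    let ρ : Equiv.Perm (ZMod d) → T.almostPrescribedStar (dihedralPerm d) ⊤ := fun p =>
      ⟨_, T.rotation_mem_star hR hP.le_left le_top v₀ (Subgroup.mem_top p)⟩
    refine ⟨ρ (Equiv.swap a b), ρ (Equiv.swap b c), fun h => ?_⟩
    have h1 : T.rotation hR v₀ (Equiv.swap a b) * T.rotation hR v₀ (Equiv.swap b c) =
      T.rotation hR v₀ (Equiv.swap b c) * T.rotation hR v₀ (Equiv.swap a b) :=
      congrArg Subtype.val h
    rw [← rotation_mul, ← rotation_mul] at h1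
    have h2 := congrArg (fun g => T.localPerm g v₀ a) h1
    simp only [localPerm_rotation_self, Equiv.Perm.mul_apply] at h2
    rw [Equiv.swap_apply_of_ne_of_ne hab hac, Equiv.swap_apply_left, Equiv.swap_apply_left] at h2
    exact hbc h2

theorem mainTheorem6 :
    (∃ (G : Type) (_ : Group G) (_ : TopologicalSpace G),
      IsNondiscreteSimpleLCGroup G ∧
        ∃ Γ : Subgroup G, IsCocompactLattice Γ ∧ IsSimpleGroup Γ) ∧
    (∀ (d : ℕ) [NeZero d], 7 ≤ d → (d % 4 = 0 ∨ d % 4 = 3) →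
      ∀ (V : Type*) (T : ColoredTree V (ZMod d)),
        IsNondiscreteSimpleLCGroup (T.almostPrescribedStar (dihedralPerm d) ⊤) ∧
        T.almostPrescribedStar (dihedralPerm d ⊓ alternatingGroup (ZMod d))
            (alternatingGroup (ZMod d)) ≤
          T.almostPrescribedStar (dihedralPerm d) ⊤ ∧
        IsCocompactLattice
          ((T.almostPrescribedStar (dihedralPerm d ⊓ alternatingGroup (ZMod d))
              (alternatingGroup (ZMod d))).subgroupOf
            (T.almostPrescribedStar (dihedralPerm d) ⊤)) ∧
        IsSimpleGroup
          (T.almostPrescribedStar (dihedralPerm d ⊓ alternatingGroup (ZMod d))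
            (alternatingGroup (ZMod d)))) := by
  refine ⟨?_, fun d _ h7 hd V T => ?_⟩
  · let T := ReducedWord.coloredTree (Ω := ZMod 7)
    have h := T.isNondiscreteSimpleLCGroup_and_isCocompactLattice le_rfl (Or.inr rfl)
    refine ⟨_, _, _, h.1, _, h.2, ?_⟩
    have hsimple := T.isSimpleGroup_almostPrescribedStar
      (dihedralPerm.isSimplePair_alternating (Or.inr rfl) le_rfl)
    exact (Subgroup.subgroupOfEquivOfLe (ColoredTree.almostPrescribedStar_mono _ inf_le_left
      le_top)).isSimpleGroup
  · have h := T.isNondiscreteSimpleLCGroup_and_isCocompactLattice h7 hd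
    exact ⟨h.1, T.almostPrescribedStar_mono inf_le_left le_top, h.2,
      T.isSimpleGroup_almostPrescribedStar (dihedralPerm.isSimplePair_alternating hd h7)⟩
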